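/- Let $Y$ be a $C^\infty$ $n$-manifold with corners (Hausdorff, paracompact, locally modelled on $[0,\infty)^l\times\mathbb R^{n-l}$), with interior $\mathrm{Int}\,Y$ and boundary $\partial Y=Y\setminus \mathrm{Int}\,Y$. For an open set $V\subset Y$ let $\mathrm{fr}\,V$ be its topological frontier and let $W_V:=\overline{\mathrm{fr}\,V\cap \mathrm{Int}\,Y}$ (the wall of $V$). A finite open covering $\mathfrak U=\{U_j\}_{j\in J}$ of $Y$ is called *regular* if the following conditions hold. 1. Each $\overline{U_j}$ is an embedded $n$-dimensional submanifold with corners in $Y$ such that - (a) $\overline{U_j}\cap\mathrm{Int}\,Y$ is a smooth manifold with boundary (it has no corners of codimension $\ge 2$); - (b) each codimension-$k$ corner point of $\overline{U_j}$, $k\ge 2$, either is a codimension-$k$ corner point of $Y$ or comes from a transverse intersection of $W_{U_j}$ with a codimension-$(k-1)$ facet of $\partial Y$; and the boundary of the manifold with corners $\overline{U_j}$ is the disjoint union of $W_{U_j}$ and $U_j\cap\partial Y$. 2. The walls $W_{U_j}$, $j\in J$, and $\partial Y$ intersect transversely: at every point $p\in Y$, the conormals at $p$ of all local hypersurface sheets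 through $p$ of the walls $W_{U_j}$ and of all local boundary hypersurfaces of $Y$ through $p$ are together linearly independent. A *partition* of $Y$ is a collection $\mathcal P$ of connected $C^\infty$ $n$-manifolds with corners (blocks) embedded in $Y$, whose union is $Y$ and whose interiors are pairwise disjoint. It is *regular* if every $p\in Y$, lying in the codimension-$l$ stratum of $Y$ (with $l=0$ for $p\in\mathrm{Int}\,Y$), has arbitrarily small open neighbourhoods which, with the induced partition, are diffeomorphic, with $p$ going to the origin, to a neighbourhood of the origin in $[0,\infty)^l\times\mathbb R^k\times\mathbb R^{n-l-k}$ for some $k\in\{0,\dots,n-l\}$, where the factor $\mathbb R^k$ is partitioned into its $2^k$ closed coordinate quadrants. **Lemma.** Let $\mathfrak U=\{U_j\}_{j\in J}$ be a regular finite open covering of $Y$, let $\chi:Y\to 2^J$ be the map $\chi(p)=\{j\in J : p\in U_j\}$, and for $J'\subset J$ with $\chi^{-1}(J')\ne\emptyset$ let $Y_{J'}:=\overline{\chi^{-1}(J')}$. Then the collection $\mathcal P_{\mathfrak U}$ of all connected components of the sets $Y_{J'}$ is a regular partition of $Y$. -/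

import Mathlib

open Set Filter Topology
open scoped Manifold ContDiff

noncomputable section

/-!
The model of an `n`-manifold with corners is the quadrant `[0, ∞)ⁿ ⊆ ℝⁿ`. For `p : Y`,
`extChartAt (modelWithCornersEuclideanQuadrant n) p` is a smooth coordinate system around `p` with
values in `[0, ∞)ⁿ`; the hypersurfaces of `∂Y` through `p` are the coordinate hypersurfaces
`xᵢ = 0` for those `i` for which the `i`-th coordinate of `p` vanishes.
-/

section Submanifolds

variable (n : ℕ) {Y : Type*} [TopologicalSpace Y] [ChartedSpace (EuclideanQuadrant n) Y]

/-- The coordinates (in the preferred coordinate system at `p`) that vanish at `p`. They label the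
local hypersurfaces of `∂Y` through `p`. -/
def vanishingCoords (p : Y) : Set (Fin n) :=
  {i | extChartAt (modelWithCornersEuclideanQuadrant n) p p i = 0}

/-- The codimension `l` of the stratum of `Y` containing `p`: around `p`, the manifold `Y` looks
like `[0, ∞)ˡ × ℝⁿ⁻ˡ` around the origin. Interior points have `l = 0`, boundary points `l = 1`,
corner points `l ≥ 2`. -/
def cornerDepth (p : Y) : ℕ := (vanishingCoords n p).ncard

/-- A corner chart at `p` of a subset `B` of `Y`: a smooth diffeomorphism `e` between open subsets
of `ℝⁿ`, defined around the coordinates of `p` and mapping them to `0`, which maps (the coordinate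
image of) `B` near `p` onto a neighbourhood of the origin in the set of all `y` with `yᵢ ≥ 0` for
`i ∈ faces`, that is in `[0, ∞)ᵏ × ℝⁿ⁻ᵏ` up to the order of the coordinates, where `k` is the
number of elements of `faces`. -/
structure CornerChart (B : Set Y) (p : Y) where
  /-- the diffeomorphism that straightens `B` -/
  e : OpenPartialHomeomorph (EuclideanSpace ℝ (Fin n)) (EuclideanSpace ℝ (Fin n))
  /-- the coordinates of `e` that cut out the local boundary hypersurfaces of `B` -/
  faces : Finset (Fin n)
  contDiffOn_e : ContDiffOn ℝ ∞ e e.source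
  contDiffOn_symm : ContDiffOn ℝ ∞ e.symm e.target
  mem_source : extChartAt (modelWithCornersEuclideanQuadrant n) p p ∈ e.source
  map_base : e (extChartAt (modelWithCornersEuclideanQuadrant n) p p) = 0
  eventually_mem_iff : ∀ᶠ x in 𝓝 (extChartAt (modelWithCornersEuclideanQuadrant n) p p),
    (x ∈ (extChartAt (modelWithCornersEuclideanQuadrant n) p).target ∧
      (extChartAt (modelWithCornersEuclideanQuadrant n) p).symm x ∈ B) ↔
    ∀ i ∈ faces, 0 ≤ e x i

/-- The conormal at `p` of the `a`-th coordinate hypersurface of a corner chart: the differential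
of the `a`-th component of `e`, a linear form on `ℝⁿ` whose kernel is the tangent hyperplane. -/
def CornerChart.conormal {n : ℕ} {B : Set Y} {p : Y} [ChartedSpace (EuclideanQuadrant n) Y]
    (c : CornerChart n B p) (a : Fin n) : EuclideanSpace ℝ (Fin n) →L[ℝ] ℝ :=
  (EuclideanSpace.proj a : EuclideanSpace ℝ (Fin n) →L[ℝ] ℝ).comp
    (fderiv ℝ c.e (extChartAt (modelWithCornersEuclideanQuadrant n) p p))

/-- `p` is a point of `B` around which `B` is an embedded `n`-dimensional manifold with corners,
and `p` lies in the codimension-`k` stratum of `B`. -/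
def IsCornerPoint (B : Set Y) (p : Y) (k : ℕ) : Prop :=
  ∃ c : CornerChart n B p, c.faces.card = k

/-- `B` is an embedded `n`-dimensional submanifold with corners of the `n`-manifold with corners
`Y`. -/
def IsCornerSubmanifold (B : Set Y) : Prop :=
  ∀ p ∈ B, ∃ k, IsCornerPoint n B p k

/-- The boundary of `B` as a manifold with corners. (It differs from the topological frontier: it
contains `B ∩ ∂Y`.) -/
def cornerBoundary (B : Set Y) : Set Y :=
  {p ∈ B | ∃ k, 1 ≤ k ∧ IsCornerPoint n B p k}

end Submanifolds

section Coverings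

variable (n : ℕ) {Y : Type*} [TopologicalSpace Y] [ChartedSpace (EuclideanQuadrant n) Y]

/-- The wall of an open set `V`: the closure in `Y` of the part of its topological frontier that
lies in the interior of `Y`. -/
def wall (V : Set Y) : Set Y :=
  closure (frontier V ∩ (modelWithCornersEuclideanQuadrant n).interior Y)

/-- The local sheets of the wall of `V` at `p`, with respect to a corner chart of `closure V`: the
boundary hypersurfaces of `closure V` on which points of the frontier of `V` in the interior of `Y`
accumulate at `p`. -/
def wallSheets (V : Set Y) (p : Y) (c : CornerChart n (closure V) p) : Set (Fin n) :=
  {a | a ∈ c.faces ∧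
    p ∈ closure {q | q ∈ frontier V ∩ (modelWithCornersEuclideanQuadrant n).interior Y ∧
      q ∈ (extChartAt (modelWithCornersEuclideanQuadrant n) p).source ∧
      c.e (extChartAt (modelWithCornersEuclideanQuadrant n) p q) a = 0}}

/-- The walls of the `U j` and the hypersurfaces of `∂Y` intersect transversely at `p`: the
conormals at `p` of all local sheets through `p` of the walls and of all local hypersurfaces of
`∂Y` through `p` are together linearly independent. -/
def WallsTransverseAt {J : Type*} (U : J → Set Y) (p : Y) : Prop :=
  ∀ c : (j : {j : J // p ∈ wall n (U j)}) → CornerChart n (closure (U j)) p,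
    LinearIndependent ℝ
      (Sum.elim
        (fun i : vanishingCoords n p =>
          (EuclideanSpace.proj (i : Fin n) : EuclideanSpace ℝ (Fin n) →L[ℝ] ℝ))
        (fun s : (j : {j : J // p ∈ wall n (U j)}) × wallSheets n (U j) p (c j) =>
          (c s.1).conormal (s.2 : Fin n)))

/-- Regular open coverings of an `n`-manifold with corners. -/
structure IsRegularCovering {J : Type*} (U : J → Set Y) : Prop where
  isOpen : ∀ j, IsOpen (U j)
  covers : ⋃ j, U j = univ
  /-- the closures are embedded submanifolds with corners -/
  submanifold : ∀ j, IsCornerSubmanifold n (closure (U j))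
  /-- inside the interior of `Y`, the closures are manifolds with boundary, without corners -/
  no_interior_corners : ∀ j, ∀ p ∈ closure (U j) ∩ (modelWithCornersEuclideanQuadrant n).interior Y,
    ∃ k, k ≤ 1 ∧ IsCornerPoint n (closure (U j)) p k
  /-- a codimension-`k` corner point of the closure, `k ≥ 2`, is a codimension-`k` corner point of
  `Y` or comes from a transverse intersection of the wall with a codimension-`(k - 1)` facet of
  `∂Y` -/
  corners : ∀ j p k, 2 ≤ k → IsCornerPoint n (closure (U j)) p k →
    cornerDepth n p = k ∨
      (p ∈ wall n (U j) ∧ cornerDepth n p + 1 = k ∧ WallsTransverseAt n (fun _ : Unit => U j) p)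
  /-- the boundary of the closure consists of the wall and of the part of `∂Y` in `U j` (these two
  are disjoint, `U j` being open) -/
  boundary_eq : ∀ j, cornerBoundary n (closure (U j)) =
    wall n (U j) ∪ (U j ∩ (modelWithCornersEuclideanQuadrant n).boundary Y)
  /-- the walls intersect transversely with one another and with `∂Y` -/
  transverse : ∀ p, WallsTransverseAt n U p

end Coverings

section Partitions

variable (n : ℕ) {Y : Type*} [TopologicalSpace Y] [ChartedSpace (EuclideanQuadrant n) Y]

/-- A partition of `Y`: a collection of connected embedded `n`-dimensional submanifolds with
corners that cover `Y` and whose interiors are disjoint from each other. (Disjointness of the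
topological interiors in `Y` contains disjointness of the manifold interiors.) -/
structure IsCornerPartition (P : Set (Set Y)) : Prop where
  covers : ⋃₀ P = univ
  connected : ∀ B ∈ P, IsConnected B
  submanifold : ∀ B ∈ P, IsCornerSubmanifold n B
  disjoint : P.Pairwise fun B B' => Disjoint (interior B) (interior B')

/-- The closed coordinate quadrant of `ℝᵏ × ℝⁿ⁻ᵏ`, where `ℝᵏ` is spanned by the coordinates in `K`,
on which the coordinates in `s` are `≥ 0` and those in `K \ s` are `≤ 0`. -/
def signQuadrant (K s : Finset (Fin n)) : Set (EuclideanSpace ℝ (Fin n)) :=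
  {x | ∀ i ∈ K, (i ∈ s → 0 ≤ x i) ∧ (i ∉ s → x i ≤ 0)}

/-- A regular partition: every point `p` of `Y`, say in the codimension-`l` stratum of `Y`, has
arbitrarily small open neighbourhoods that are diffeomorphic, by a map `ψ` taking `p` to the origin,
to a neighbourhood of the origin in `[0, ∞)ˡ × ℝᵏ × ℝⁿ⁻ˡ⁻ᵏ` for some `k`, in such a way that the
induced partition corresponds to the partition of the factor `ℝᵏ` into its `2ᵏ` coordinate
quadrants. The factors `[0, ∞)ˡ` and `ℝᵏ` are spanned by the coordinates in `L` and `K`. -/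
structure IsRegularPartition (P : Set (Set Y)) : Prop extends IsCornerPartition n P where
  local_model : ∀ p : Y, ∀ N ∈ 𝓝 p,
    ∃ (L K : Finset (Fin n)) (ψ : PartialEquiv Y (EuclideanSpace ℝ (Fin n)))
      (W : Set (EuclideanSpace ℝ (Fin n))),
      Disjoint L K ∧ L.card = cornerDepth n p ∧
      IsOpen ψ.source ∧ p ∈ ψ.source ∧ ψ.source ⊆ N ∧ ψ p = 0 ∧
      IsOpen W ∧ ψ.target = W ∩ {x | ∀ i ∈ L, 0 ≤ x i} ∧
      ContMDiffOn (modelWithCornersEuclideanQuadrant n) (𝓡 n) ∞ ψ ψ.source ∧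
      ContMDiffOn (𝓡 n) (modelWithCornersEuclideanQuadrant n) ∞ ψ.symm ψ.target ∧
      {S | ∃ B ∈ P, (B ∩ ψ.source).Nonempty ∧ S = B ∩ ψ.source} =
        {S | ∃ s ⊆ K, S = ψ.source ∩ ψ ⁻¹' signQuadrant n K s}

end Partitions

/-- The characteristic map of a covering: `p` is sent to the set of all `j` with `p ∈ U j`. -/
def coveringType {Y J : Type*} (U : J → Set Y) (p : Y) : Set J := {j | p ∈ U j}

/-- The collection of the connected components of the closures of the (nonempty) level sets of the
characteristic map. -/
def associatedPartition {Y J : Type*} [TopologicalSpace Y] (U : J → Set Y) : Set (Set Y) :=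
  {B | ∃ T : Set J, ∃ p ∈ closure (coveringType U ⁻¹' {T}),
    B = connectedComponentIn (closure (coveringType U ⁻¹' {T})) p}

end

-- The statement is local around a point `p`. If `p` is not on the frontier of `U j`, membership in
-- `U j` is constant near `p`. If it is, `U j` is near `p` the set where one smooth function, the
-- equation of its wall, is positive. By transversality these functions and the coordinates cutting
-- out `∂Y` have independent differentials, so they belong to one coordinate system centred at `p`
-- whose image is a cube cut by half-spaces (`AdaptedChart`).
--
-- There the characteristic map depends only on the signs of the wall coordinates, and the closures
-- of its level sets are the closed quadrants. Each is convex and contains `p`, so a connected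
-- component of a closed level set meets the chart domain in a whole quadrant or not at all. This is
-- the local model, and sign changes turn it into corner charts of the blocks.
--
-- The work lies in the one-sided description of `U j`, since regularity describes only `closure (U
-- j)`, as a set where several face coordinates are nonnegative. Comparing the number of faces with
-- the corner depth leaves a single wall sheet (`exists_wallSheets_eq_singleton`). A connectedness
-- argument then shows that the other faces impose nothing beyond `∂Y` (`eventually_mem_iff_pos`).

local notation "𝓒" => modelWithCornersEuclideanQuadrant

/-! ### Linear coordinates and the inverse function theorem -/

/-- A linearly independent family of continuous linear forms on `ℝⁿ` is part of a linear coordinate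
system. -/
theorem exists_continuousLinearEquiv_apply_eq {n : ℕ} {ι : Type*} [Finite ι]
    {g : ι → EuclideanSpace ℝ (Fin n) →L[ℝ] ℝ} (hg : LinearIndependent ℝ g) :
    ∃ (σ : ι → Fin n) (A : EuclideanSpace ℝ (Fin n) ≃L[ℝ] EuclideanSpace ℝ (Fin n)),
      Function.Injective σ ∧ ∀ i x, A x (σ i) = g i x := by
  classical
  let b := Module.Basis.sumExtend hg
  have : Fintype (ι ⊕ Module.Basis.sumExtendIndex hg) :=
    Module.Basis.fintypeIndexOfRankLtAleph0 b (Module.rank_lt_aleph0 ℝ _)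
  have hcard : Fintype.card (ι ⊕ Module.Basis.sumExtendIndex hg) = Fintype.card (Fin n) := by
    rw [← Module.finrank_eq_card_basis b,
      ← (LinearMap.toContinuousLinearMap (𝕜 := ℝ) (E := EuclideanSpace ℝ (Fin n))
        (F' := ℝ)).finrank_eq, Subspace.dual_finrank_eq]
    simp
  let τ := Fintype.equivOfCardEq hcard
  let T : EuclideanSpace ℝ (Fin n) →ₗ[ℝ] EuclideanSpace ℝ (Fin n) :=
    { toFun := fun x => WithLp.toLp 2 fun m => b (τ.symm m) x
      map_add' := fun x y => by ext m; simp
      map_smul' := fun r x => by ext m; simp }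
  have hT : Function.Injective T := by
    refine (injective_iff_map_eq_zero T).2 fun x hx => ?_
    -- Evaluation at `x` kills a basis of the dual space, hence every coordinate form.
    let ev : (EuclideanSpace ℝ (Fin n) →L[ℝ] ℝ) →ₗ[ℝ] ℝ :=
      { toFun := fun φ => φ x, map_add' := fun _ _ => rfl, map_smul' := fun _ _ => rfl }
    have hev : ev = 0 := b.ext fun k => by
      have := congrArg (fun y : EuclideanSpace ℝ (Fin n) => y (τ k)) hx
      change b k x = 0
      simpa [T] using this
    ext m
    exact LinearMap.congr_fun hev (EuclideanSpace.proj m)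
  refine ⟨fun i => τ (Sum.inl i), (LinearEquiv.ofInjectiveEndo T hT).toContinuousLinearEquiv,
    fun i j h => Sum.inl_injective (τ.injective h), fun i x => ?_⟩
  have hb : b (Sum.inl i) = g i := by 
    simp only [b, Module.Basis.sumExtend, Module.Basis.reindex_apply,
      Module.Basis.extend_apply_self]
    rfl
  change b (τ.symm (τ (Sum.inl i))) x = g i x
  rw [Equiv.symm_apply_apply, hb]

/-- Functions that vanish at `x₀` and have linearly independent differentials there are part of a
smooth coordinate system centred at `x₀`. -/
theorem exists_straightening {n : ℕ} {ι : Type*} [Finite ι]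
    {f : ι → EuclideanSpace ℝ (Fin n) → ℝ} {x₀ : EuclideanSpace ℝ (Fin n)}
    {O : Set (EuclideanSpace ℝ (Fin n))} (hO : O ∈ 𝓝 x₀)
    (hf : ∀ i, ContDiffOn ℝ ∞ (f i) O) (hf0 : ∀ i, f i x₀ = 0)
    (hind : LinearIndependent ℝ fun i => fderiv ℝ (f i) x₀) :
    ∃ (σ : ι → Fin n)
      (Ψ : OpenPartialHomeomorph (EuclideanSpace ℝ (Fin n)) (EuclideanSpace ℝ (Fin n))),
      Function.Injective σ ∧ x₀ ∈ Ψ.source ∧ Ψ.source ⊆ O ∧ Ψ x₀ = 0 ∧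
      ContDiffOn ℝ ∞ Ψ Ψ.source ∧ ContDiffOn ℝ ∞ Ψ.symm Ψ.target ∧
      ∀ i, ∀ x, Ψ x (σ i) = f i x := by
  classical
  obtain ⟨σ, A, hσ, hA⟩ := exists_continuousLinearEquiv_apply_eq hind
  -- The `f i` fill the coordinates chosen by `σ` and an affine map fills the others, so the
  -- derivative at `x₀` is exactly `A`.
  let F : EuclideanSpace ℝ (Fin n) → EuclideanSpace ℝ (Fin n) := fun x =>
    WithLp.toLp 2 fun m => if h : ∃ i, σ i = m then f h.choose x else A (x - x₀) m
  have hFσ : ∀ i x, F x (σ i) = f i x := fun i x => by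
    have h : ∃ i', σ i' = σ i := ⟨i, rfl⟩
    simp only [F, dif_pos h, hσ h.choose_spec]
  have hFn : ∀ m, (¬ ∃ i, σ i = m) → ∀ x, F x m = A (x - x₀) m := fun m h x => by
    simp only [F, dif_neg h]
  have hF0 : F x₀ = 0 := by
    ext m
    by_cases h : ∃ i, σ i = m
    · obtain ⟨i, rfl⟩ := h
      simp [hFσ, hf0]
    · simp [hFn m h]
  have hsmooth : ContDiffOn ℝ ∞ F (interior O) := by
    rw [contDiffOn_euclidean]
    intro m
    by_cases h : ∃ i, σ i = m
    · obtain ⟨i, rfl⟩ := h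
      simp only [hFσ]
      exact (hf i).mono interior_subset
    · simp only [hFn m h]
      have h1 : ContDiff ℝ ∞ fun x => A (x - x₀) := A.contDiff.comp (contDiff_id.sub contDiff_const)
      exact (contDiff_euclidean.1 h1 m).contDiffOn
  have hx₀ : x₀ ∈ interior O := mem_interior_iff_mem_nhds.2 hO
  have hder : HasFDerivAt F (A : EuclideanSpace ℝ (Fin n) →L[ℝ] EuclideanSpace ℝ (Fin n)) x₀ := by
    rw [← hasFDerivWithinAt_univ, hasFDerivWithinAt_euclidean]
    intro m
    rw [hasFDerivWithinAt_univ]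
    by_cases h : ∃ i, σ i = m
    · obtain ⟨i, rfl⟩ := h
      simp only [hFσ]
      have hd : DifferentiableAt ℝ (f i) x₀ :=
        ((hf i).contDiffAt hO).differentiableAt (by simp)
      have hAi : PiLp.proj 2 (fun _ : Fin n => ℝ) (σ i) ∘SL
          (A : EuclideanSpace ℝ (Fin n) →L[ℝ] EuclideanSpace ℝ (Fin n)) = fderiv ℝ (f i) x₀ :=
        ContinuousLinearMap.ext fun x => hA i x
      rw [hAi]
      exact hd.hasFDerivAt
    · simp only [hFn m h]
      have h1 : HasFDerivAt (fun x => A (x - x₀))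
          (A : EuclideanSpace ℝ (Fin n) →L[ℝ] EuclideanSpace ℝ (Fin n)) x₀ := by
        exact A.hasFDerivAt.comp x₀ ((hasFDerivAt_id x₀).sub_const x₀)
      rw [← hasFDerivWithinAt_univ] at h1 ⊢
      exact hasFDerivWithinAt_euclidean.1 h1 m
  have hat : ContDiffAt ℝ ∞ F x₀ := hsmooth.contDiffAt (isOpen_interior.mem_nhds hx₀)
  let Φ := hat.toOpenPartialHomeomorph F hder (by simp)
  have hΦ : ∀ x, Φ x = F x := fun x => rfl
  have hcont : ContinuousAt (fderiv ℝ F) x₀ := hat.continuousAt_fderiv (by simp)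
  -- Shrinking to points with invertible derivative makes the inverse smooth on the whole target,
  -- not only at the image of `x₀`.
  have hinv : ∀ᶠ x in 𝓝 x₀, fderiv ℝ F x ∈ range ((↑) :
      (EuclideanSpace ℝ (Fin n) ≃L[ℝ] EuclideanSpace ℝ (Fin n)) →
        EuclideanSpace ℝ (Fin n) →L[ℝ] EuclideanSpace ℝ (Fin n)) :=
    hcont (by rw [hder.fderiv]; exact A.nhds)
  obtain ⟨O', hO', hO'o, hx₀'⟩ := eventually_nhds_iff.1 hinv
  let S := interior O ∩ O'
  have hS : IsOpen S := isOpen_interior.inter hO'o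
  refine ⟨σ, Φ.restrOpen S hS, hσ,
    ⟨hat.mem_toOpenPartialHomeomorph_source hder (by simp), hx₀, hx₀'⟩,
    fun x hx => interior_subset hx.2.1, hF0, hsmooth.mono fun x hx => hx.2.1, ?_, hFσ⟩
  intro y hy
  have hys : Φ.symm y ∈ S := ((Φ.restrOpen S hS).map_target hy).2
  obtain ⟨A', hA'⟩ := hO' _ hys.2
  have hc : ContDiffAt ℝ ∞ F (Φ.symm y) :=
    hsmooth.contDiffAt (isOpen_interior.mem_nhds hys.1)
  refine ContDiffAt.contDiffWithinAt ?_
  refine Φ.contDiffAt_symm (f₀' := A') hy.1 ?_ hc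
  rw [hA']
  exact (hc.differentiableAt (by simp)).hasFDerivAt

/-! ### Quadrant charts, interior points and frontiers -/

section Charts

variable {n : ℕ} {Y : Type*} [TopologicalSpace Y] [ChartedSpace (EuclideanQuadrant n) Y]

theorem range_modelWithCornersEuclideanQuadrant (n : ℕ) :
    range (𝓒 n) = {x : EuclideanSpace ℝ (Fin n) | ∀ i, 0 ≤ x i} :=
  range_euclideanQuadrant n

theorem extChartAt_target_nonneg {p : Y} {x : EuclideanSpace ℝ (Fin n)}
    (hx : x ∈ (extChartAt (𝓒 n) p).target) (i : Fin n) : 0 ≤ x i := by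
  have h := extChartAt_target_subset_range (I := 𝓒 n) p hx
  rw [range_modelWithCornersEuclideanQuadrant] at h
  exact h i

/-- A neighbourhood of a point corresponds to a relative neighbourhood in the quadrant of its
image in a chart. -/
theorem eventually_extChartAt_symm_iff {p q : Y} (hq : q ∈ (extChartAt (𝓒 n) p).source)
    {P : Y → Prop} :
    (∀ᶠ x in 𝓝 (extChartAt (𝓒 n) p q), (∀ i, 0 ≤ x i) →
      x ∈ (extChartAt (𝓒 n) p).target ∧ P ((extChartAt (𝓒 n) p).symm x)) ↔
    ∀ᶠ q' in 𝓝 q, P q' := by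
  rw [← map_extChartAt_symm_nhdsWithin_range' (I := 𝓒 n) hq, eventually_map,
    range_modelWithCornersEuclideanQuadrant]
  have h : ∀ᶠ x in 𝓝[{x | ∀ i, 0 ≤ x i}] (extChartAt (𝓒 n) p q),
      x ∈ (extChartAt (𝓒 n) p).target := by
    rw [← range_modelWithCornersEuclideanQuadrant]
    exact extChartAt_target_mem_nhdsWithin' hq
  constructor
  · intro h1
    rw [eventually_nhdsWithin_iff]
    filter_upwards [h1] with x hx hxQ using (hx hxQ).2
  · intro h1
    have h2 := h.and h1
    rwa [eventually_nhdsWithin_iff] at h2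

/-- Being an interior point is independent of the chart, so the chart centred at `p` may be used at
every nearby `q`. -/
theorem mem_interior_iff_extChartAt [IsManifold (𝓒 n) ∞ Y] {p q : Y}
    (hq : q ∈ (extChartAt (𝓒 n) p).source) :
    q ∈ (𝓒 n).interior Y ↔ ∀ i, 0 < extChartAt (𝓒 n) p q i := by
  have hq' : q ∈ (chartAt (EuclideanQuadrant n) p).source := by rwa [extChartAt_source] at hq
  have hint : interior (range (𝓒 n)) = {x : EuclideanSpace ℝ (Fin n) | ∀ i, 0 < x i} := by
    rw [range_modelWithCornersEuclideanQuadrant, interior_euclideanQuadrant]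
  have h := (𝓒 n).isInteriorPoint_iff_of_mem_atlas (n := ∞) (by simp)
    (chart_mem_atlas (EuclideanQuadrant n) p) hq'
  change (𝓒 n).IsInteriorPoint q ↔ extChartAt (𝓒 n) p q ∈ {x | ∀ i, 0 < x i}
  rw [h, ← hint]
  exact ⟨fun h => OpenPartialHomeomorph.interior_extend_target_subset_interior_range _ h,
    fun h => (chartAt (EuclideanQuadrant n) p).mem_interior_extend_target
      ((chartAt (EuclideanQuadrant n) p).map_source hq') h⟩

theorem extChartAt_nonneg {p q : Y} (hq : q ∈ (extChartAt (𝓒 n) p).source) (i : Fin n) :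
    0 ≤ extChartAt (𝓒 n) p q i :=
  extChartAt_target_nonneg ((extChartAt (𝓒 n) p).map_source hq) i

theorem frequently_pos_of_nonneg {x : EuclideanSpace ℝ (Fin n)} (hx : ∀ i, 0 ≤ x i) :
    ∃ᶠ y in 𝓝 x, ∀ i, 0 < y i := by
  have h : Tendsto (fun t : ℝ => x + t • (WithLp.toLp 2 fun _ => (1 : ℝ)))
      (𝓝[>] 0) (𝓝 x) := by
    have : Continuous fun t : ℝ =>
        x + t • (WithLp.toLp 2 fun _ => (1 : ℝ) : EuclideanSpace ℝ (Fin n)) := by fun_prop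
    simpa using (this.tendsto 0).mono_left nhdsWithin_le_nhds
  refine h.frequently (Eventually.frequently ?_)
  filter_upwards [self_mem_nhdsWithin] with t ht i
  have := hx i
  have ht' : (0 : ℝ) < t := ht
  simp only [PiLp.add_apply, PiLp.smul_apply, smul_eq_mul, mul_one]
  linarith

/-- The interior of a manifold with corners is dense. -/
theorem frequently_mem_interior [IsManifold (𝓒 n) ∞ Y] (p : Y) :
    ∃ᶠ q in 𝓝 p, q ∈ (𝓒 n).interior Y := by
  intro h
  have hp := mem_extChartAt_source (I := 𝓒 n) p
  rw [← eventually_extChartAt_symm_iff hp] at h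
  refine frequently_pos_of_nonneg (extChartAt_nonneg hp) ?_
  filter_upwards [h] with x hx hpos
  obtain ⟨hxt, hxn⟩ := hx fun i => (hpos i).le
  refine hxn ((mem_interior_iff_extChartAt ((extChartAt (𝓒 n) p).map_target hxt)).2 ?_)
  rwa [(extChartAt (𝓒 n) p).right_inv hxt]

namespace CornerChart

variable {B : Set Y} {p : Y} (c : CornerChart n B p)

theorem source_mem_nhds : c.e.source ∈ 𝓝 (extChartAt (𝓒 n) p p) :=
  c.e.open_source.mem_nhds c.mem_source

theorem contDiffOn_apply (i : Fin n) : ContDiffOn ℝ ∞ (fun x => c.e x i) c.e.source :=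
  contDiffOn_euclidean.1 c.contDiffOn_e i

theorem differentiableAt : DifferentiableAt ℝ c.e (extChartAt (𝓒 n) p p) :=
  (c.contDiffOn_e.contDiffAt c.source_mem_nhds).differentiableAt (by simp)

theorem conormal_eq_fderiv (a : Fin n) :
    c.conormal a = fderiv ℝ (fun x => c.e x a) (extChartAt (𝓒 n) p p) := by
  have h := (hasFDerivAt_pi' (𝕜 := ℝ)).1 ((PiLp.hasFDerivAt_ofLp 2 _).comp _
    c.differentiableAt.hasFDerivAt) a
  exact h.fderiv.symm

/-- Arbitrarily close to the base point, every coordinate of a corner chart takes negative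
values. -/
theorem frequently_neg (a : Fin n) {x : EuclideanSpace ℝ (Fin n)} (hx : x ∈ c.e.source)
    (hxa : c.e x a ≤ 0) : ∃ᶠ y in 𝓝 x, c.e y a < 0 := by
  intro h
  have h1 : ∀ᶠ y in 𝓝 (c.e x), ¬ y a < 0 := by
    have h2 : Tendsto c.e.symm (𝓝 (c.e x)) (𝓝 x) := by
      have h3 := (c.e.continuousAt_symm (c.e.map_source hx)).tendsto
      rwa [c.e.left_inv hx] at h3
    filter_upwards [h2.eventually h, c.e.open_target.mem_nhds (c.e.map_source hx)] with y hy hyt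
    rwa [c.e.right_inv hyt] at hy
  have h3 : Tendsto (fun t : ℝ => c.e x - t • EuclideanSpace.single a (1 : ℝ)) (𝓝[>] 0)
      (𝓝 (c.e x)) := by
    have : Continuous fun t : ℝ => c.e x - t • EuclideanSpace.single a (1 : ℝ) := by fun_prop
    simpa using (this.tendsto 0).mono_left nhdsWithin_le_nhds
  obtain ⟨t, ht, ht0⟩ := ((h3.eventually h1).and self_mem_nhdsWithin).exists
  have ht0' : (0 : ℝ) < t := ht0
  refine ht ?_
  simp
  linarith

end CornerChart

/-- Around an interior point the chart image is a full neighbourhood in `ℝⁿ`, and a face coordinate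
takes negative values there, which leads out of `B`. -/
theorem notMem_nhds_of_mem_cornerBoundary [IsManifold (𝓒 n) ∞ Y] {B : Set Y} {q : Y}
    (hq : q ∈ cornerBoundary n B) (hqi : q ∈ (𝓒 n).interior Y) : B ∉ 𝓝 q := by
  intro hB
  obtain ⟨-, k, hk, c, hc⟩ := hq
  obtain ⟨a, ha⟩ := Finset.card_pos.1 (by omega : 0 < c.faces.card)
  have hs := mem_extChartAt_source (I := 𝓒 n) q
  have h1 := (eventually_extChartAt_symm_iff hs).2 hB
  have h2 := (mem_interior_iff_extChartAt hs).1 hqi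
  have h3 : ∀ᶠ x in 𝓝 (extChartAt (𝓒 n) q q), ∀ i, 0 < x i :=
    eventually_all.2 fun i =>
      ((PiLp.continuous_apply 2 _ i).continuousAt).eventually (lt_mem_nhds (h2 i))
  refine c.frequently_neg a c.mem_source (by rw [c.map_base]; rfl) ?_
  filter_upwards [h1, h3, c.eventually_mem_iff] with x hx1 hx3 hx
  exact not_lt.2 (hx.1 (hx1 fun i => (hx3 i).le) a ha)

namespace IsRegularCovering

variable {J : Type*} {U : J → Set Y}

/-- Only frontier points on `∂Y` are at issue. A corner chart there has a face, since otherwise the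
chart target would contain a full neighbourhood and the point would be interior. So the point lies
in the corner boundary but not in `U j`, and `boundary_eq` leaves only the wall. -/
theorem frontier_subset_wall (hU : IsRegularCovering n U) (j : J) :
    frontier (U j) ⊆ wall n (U j) := by
  intro p hp
  by_cases hpi : p ∈ (𝓒 n).interior Y
  · exact subset_closure ⟨hp, hpi⟩
  have hpU : p ∉ U j := fun h => by
    have := (hU.isOpen j).inter_frontier_eq
    exact (this ▸ ⟨h, hp⟩ : p ∈ (∅ : Set Y))
  obtain ⟨k, c, hc⟩ := hU.submanifold j p (frontier_subset_closure hp)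
  have hk : 1 ≤ k := by
    by_contra hk
    have hf : c.faces = ∅ := Finset.card_eq_zero.1 (by omega)
    have h1 := c.eventually_mem_iff
    simp only [hf, Finset.notMem_empty, false_imp_iff, implies_true, iff_true] at h1
    refine hpi ((𝓒 n).isInteriorPoint_iff.2 (mem_interior_iff_mem_nhds.2 ?_))
    filter_upwards [h1] with x hx using hx.1
  have hb : p ∈ cornerBoundary n (closure (U j)) := ⟨frontier_subset_closure hp, k, hk, c, hc⟩
  rw [hU.boundary_eq] at hb
  exact hb.resolve_right fun h => hpU h.1

theorem closure_notMem_nhds [IsManifold (𝓒 n) ∞ Y] (hU : IsRegularCovering n U) {j : J} {q : Y}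
    (hq : q ∈ frontier (U j)) (hqi : q ∈ (𝓒 n).interior Y) : closure (U j) ∉ 𝓝 q :=
  notMem_nhds_of_mem_cornerBoundary
    (hU.boundary_eq j ▸ Or.inl (hU.frontier_subset_wall j hq)) hqi

/-- Some sheet of the wall passes through each point of the frontier. -/
theorem wallSheets_nonempty [IsManifold (𝓒 n) ∞ Y] (hU : IsRegularCovering n U) {j : J} {p : Y}
    (hp : p ∈ frontier (U j)) (c : CornerChart n (closure (U j)) p) :
    (wallSheets n (U j) p c).Nonempty := by
  have hs := mem_extChartAt_source (I := 𝓒 n) p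
  have hev : ∀ᶠ q in 𝓝 p, q ∈ frontier (U j) ∩ (𝓒 n).interior Y →
      q ∈ ⋃ a ∈ c.faces, {q | q ∈ frontier (U j) ∩ (𝓒 n).interior Y ∧
        q ∈ (extChartAt (𝓒 n) p).source ∧ c.e (extChartAt (𝓒 n) p q) a = 0} := by
    have h1 := ((continuousAt_extChartAt (I := 𝓒 n) p).eventually
      (c.eventually_mem_iff.eventually_nhds.and c.source_mem_nhds))
    filter_upwards [h1, extChartAt_source_mem_nhds (I := 𝓒 n) p] with q hq hqs hqf
    obtain ⟨hq1, hqe⟩ := hq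
    have hpos := hq1.self_of_nhds.1 ⟨(extChartAt (𝓒 n) p).map_source hqs, by
      rw [(extChartAt (𝓒 n) p).left_inv hqs]; exact frontier_subset_closure hqf.1⟩
    -- If no face coordinate vanished at `q`, all would be positive and `closure (U j)` would be a
    -- neighbourhood of `q`.
    by_contra hcon
    simp only [mem_iUnion, not_exists] at hcon
    refine hU.closure_notMem_nhds hqf.1 hqf.2 ?_
    refine (eventually_extChartAt_symm_iff hqs).1 ?_
    have hpos' : ∀ᶠ x in 𝓝 (extChartAt (𝓒 n) p q), ∀ a ∈ c.faces, 0 < c.e x a := by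
      refine (Finset.eventually_all _).2 fun a ha => ?_
      have hne : c.e (extChartAt (𝓒 n) p q) a ≠ 0 := fun h => hcon a ha ⟨hqf, hqs, h⟩
      exact ((PiLp.continuous_apply 2 _ a).continuousAt.comp (c.e.continuousAt hqe)).eventually
        (lt_mem_nhds (lt_of_le_of_ne (hpos a ha) hne.symm))
    filter_upwards [hq1, hpos'] with x hx hx' _
    exact hx.2 fun a ha => (hx' a ha).le
  have hcl : p ∈ closure (⋃ a ∈ c.faces, {q | q ∈ frontier (U j) ∩ (𝓒 n).interior Y ∧
        q ∈ (extChartAt (𝓒 n) p).source ∧ c.e (extChartAt (𝓒 n) p q) a = 0}) :=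
    mem_closure_iff_frequently.2
      ((mem_closure_iff_frequently.1 (hU.frontier_subset_wall j hp)).mp
        (hev.mono fun q hq => hq))
  rw [Finset.closure_biUnion] at hcl
  simp only [mem_iUnion] at hcl
  obtain ⟨a, ha, hpa⟩ := hcl
  exact ⟨a, ha, hpa⟩

end IsRegularCovering

end Charts

/-! ### Counting the sheets of a wall -/

section Sheets

variable {n : ℕ} {Y : Type*} [TopologicalSpace Y] [ChartedSpace (EuclideanQuadrant n) Y]

namespace CornerChart

variable {B : Set Y} {p : Y} (c : CornerChart n B p)

/-- Vectors tangent to all faces of a submanifold are tangent to all hypersurfaces of `∂Y`. -/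
theorem apply_eq_zero_of_conormal_eq_zero {v : EuclideanSpace ℝ (Fin n)}
    (hv : ∀ a ∈ c.faces, c.conormal a v = 0) {i : Fin n} (hi : i ∈ vanishingCoords n p) :
    v i = 0 := by
  set x₀ := extChartAt (𝓒 n) p p with hx₀
  set D := fderiv ℝ c.e x₀ with hD
  have h0t : (0 : EuclideanSpace ℝ (Fin n)) ∈ c.e.target := by
    rw [← c.map_base]; exact c.e.map_source c.mem_source
  have hsymm0 : c.e.symm 0 = x₀ := by
    rw [← c.map_base]; exact c.e.left_inv c.mem_source
  have hd' : DifferentiableAt ℝ c.e.symm 0 :=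
    (c.contDiffOn_symm.contDiffAt (c.e.open_target.mem_nhds h0t)).differentiableAt (by simp)
  have hcomp : (fderiv ℝ c.e.symm 0).comp D = ContinuousLinearMap.id ℝ _ := by
    have h1 : HasFDerivAt (c.e.symm ∘ c.e) ((fderiv ℝ c.e.symm 0).comp D) x₀ := by
      refine HasFDerivAt.comp x₀ ?_ c.differentiableAt.hasFDerivAt
      rw [c.map_base]
      exact hd'.hasFDerivAt
    have h2 : c.e.symm ∘ c.e =ᶠ[𝓝 x₀] id := by
      filter_upwards [c.source_mem_nhds] with x hx using c.e.left_inv hx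
    exact (h1.congr_of_eventuallyEq h2.symm).unique (hasFDerivAt_id x₀)
  -- All face coordinates vanish along this curve, so it stays in the quadrant for `t` of both
  -- signs. Its `i`-th coordinate has a minimum at `0`, which forces its derivative `v i` to vanish.
  let γ : ℝ → EuclideanSpace ℝ (Fin n) := fun t => c.e.symm (t • D v)
  have hγ0 : γ 0 = x₀ := by simp [γ, hsymm0]
  have hγ : HasDerivAt γ v 0 := by
    have h1 : HasDerivAt (fun t : ℝ => t • D v) (D v) 0 := by
      simpa using (hasDerivAt_id (0 : ℝ)).smul_const (D v)
    have h2 : HasFDerivAt c.e.symm (fderiv ℝ c.e.symm 0) ((0 : ℝ) • D v) := by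
      rw [zero_smul]; exact hd'.hasFDerivAt
    have h3 := h2.comp_hasDerivAt (0 : ℝ) h1
    have h4 : (fderiv ℝ c.e.symm 0) (D v) = v := by
      simpa using congrArg (fun T => T v) hcomp
    rwa [h4] at h3
  have hγi : HasDerivAt (fun t => γ t i) (v i) 0 :=
    ((EuclideanSpace.proj i : EuclideanSpace ℝ (Fin n) →L[ℝ] ℝ).hasFDerivAt).comp_hasDerivAt
      (0 : ℝ) hγ
  refine IsLocalMin.hasDerivAt_eq_zero ?_ hγi
  have hlim : Tendsto (fun t : ℝ => t • D v) (𝓝 0) (𝓝 0) := by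
    have : Continuous fun t : ℝ => t • D v := by fun_prop
    simpa using this.tendsto 0
  have hγc : Tendsto γ (𝓝 0) (𝓝 x₀) := by
    have := hγ.continuousAt.tendsto
    rwa [hγ0] at this
  filter_upwards [hγc.eventually c.eventually_mem_iff,
    hlim.eventually (c.e.open_target.mem_nhds h0t)] with t ht htt
  have h1 : γ 0 i = 0 := by rw [hγ0]; exact hi
  rw [h1]
  refine extChartAt_target_nonneg (ht.2 fun a ha => ?_).1 i
  have h2 : c.e (γ t) = t • D v := c.e.right_inv htt
  have h3 : D v a = 0 := hv a ha
  rw [h2, PiLp.smul_apply, h3, smul_zero]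

/-- If `m` forms among the conormals of the faces are independent of the conormals of `∂Y`, then
the number of faces is at least `m` more than the corner depth. -/
theorem cornerDepth_add_ncard_le {S : Set (Fin n)} (hS : S ⊆ c.faces)
    (hind : LinearIndependent ℝ (Sum.elim
      (fun i : vanishingCoords n p =>
        (EuclideanSpace.proj (i : Fin n) : EuclideanSpace ℝ (Fin n) →L[ℝ] ℝ))
      (fun a : S => c.conormal (a : Fin n)))) :
    cornerDepth n p + S.ncard ≤ c.faces.card := by
  classical
  have hind' := hind.map' (ContinuousLinearMap.coeLM ℝ)
    (LinearMap.ker_eq_bot.2 ContinuousLinearMap.coe_injective)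
  let w : c.faces → EuclideanSpace ℝ (Fin n) →ₗ[ℝ] ℝ := fun a => (c.conormal (a : Fin n) : _ →ₗ[ℝ] ℝ)
  have : Fintype (vanishingCoords n p) := Fintype.ofFinite _
  have : Fintype S := Fintype.ofFinite _
  have hle := linearIndependent_le_span' _ hind' (range w) (by
    rintro _ ⟨i | a, rfl⟩
    -- A form vanishing on the common kernel of the face conormals lies in their span, so all the
    -- independent forms lie in a span of `c.faces.card` vectors.
    · refine mem_span_of_iInf_ker_le_ker fun v hv => ?_
      refine c.apply_eq_zero_of_conormal_eq_zero (fun a ha => ?_) i.2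
      exact (Submodule.mem_iInf _).1 hv ⟨a, ha⟩
    · exact Submodule.subset_span ⟨⟨a, hS a.2⟩, rfl⟩)
  have h2 : Fintype.card (range w) ≤ c.faces.card := by
    simpa using Fintype.card_range_le w
  rw [Cardinal.mk_fintype, Nat.cast_le, Fintype.card_sum] at hle
  rw [cornerDepth, ncard_eq_toFinset_card', ncard_eq_toFinset_card', toFinset_card, toFinset_card]
  exact hle.trans h2

end CornerChart

/-- Only one sheet of the wall passes through each point of the frontier. -/
theorem IsRegularCovering.exists_wallSheets_eq_singleton [IsManifold (𝓒 n) ∞ Y] {J : Type*}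
    {U : J → Set Y} (hU : IsRegularCovering n U) {j : J} {p : Y}
    (hp : p ∈ frontier (U j)) (c : CornerChart n (closure (U j)) p)
    (hind : LinearIndependent ℝ (Sum.elim
      (fun i : vanishingCoords n p =>
        (EuclideanSpace.proj (i : Fin n) : EuclideanSpace ℝ (Fin n) →L[ℝ] ℝ))
      (fun a : wallSheets n (U j) p c => c.conormal (a : Fin n)))) :
    ∃ a, wallSheets n (U j) p c = {a} := by
  have hne := hU.wallSheets_nonempty hp c
  have hle := c.cornerDepth_add_ncard_le (fun a ha => ha.1) hind
  have hpos := (ncard_pos (toFinite _)).2 hne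
  refine ncard_eq_one.1 ?_
  -- The depth plus the number of sheets is at most the number of faces. For at least two faces,
  -- `corners` makes the latter the depth, which leaves no room for a sheet, or the depth plus one.
  -- For at most one face the bound is immediate.
  by_cases hk : 2 ≤ c.faces.card
  · rcases hU.corners j p _ hk ⟨c, rfl⟩ with h | h
    · omega
    · have := h.2.1
      omega
  · omega

end Sheets

/-! ### Cubes and displacement along coordinate directions -/

/-- The open cube of side `2 r` around the origin. -/
def openCube (n : ℕ) (r : ℝ) : Set (EuclideanSpace ℝ (Fin n)) := {y | ∀ m, |y m| < r}

theorem isOpen_openCube (n : ℕ) (r : ℝ) : IsOpen (openCube n r) := by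
  simp only [openCube, ofPred_forall]
  exact isOpen_iInter_of_finite fun m =>
    isOpen_lt (PiLp.continuous_apply 2 _ m).abs continuous_const

theorem convex_openCube (n : ℕ) (r : ℝ) : Convex ℝ (openCube n r) := by
  intro x hx y hy s t hs ht hst m
  have h := convex_ball (0 : ℝ) r (x := x m) (by simpa using hx m) (y := y m) (by simpa using hy m)
    hs ht hst
  simpa using h

theorem zero_mem_openCube {n : ℕ} {r : ℝ} (hr : 0 < r) : 0 ∈ openCube n r := fun m => by simpa

theorem exists_openCube_subset {n : ℕ} {s : Set (EuclideanSpace ℝ (Fin n))} (hs : s ∈ 𝓝 0) :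
    ∃ r > 0, openCube n r ⊆ s := by
  have h1 : (WithLp.toLp 2 : (Fin n → ℝ) → EuclideanSpace ℝ (Fin n)) ⁻¹' s ∈ 𝓝 0 :=
    (PiLp.continuous_toLp 2 _).continuousAt.preimage_mem_nhds (by simpa using hs)
  obtain ⟨r, hr, hrs⟩ := Metric.mem_nhds_iff.1 h1
  refine ⟨r, hr, fun y hy => ?_⟩
  have hyb : WithLp.ofLp y ∈ Metric.ball (0 : Fin n → ℝ) r := by
    rw [mem_ball_zero_iff, pi_norm_lt_iff hr]
    exact hy
  exact hrs hyb

theorem OpenPartialHomeomorph.tendsto_symm_add_smul {E : Type*} [NormedAddCommGroup E]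
    [NormedSpace ℝ E] (Ψ : OpenPartialHomeomorph E E) {x : E} (hx : x ∈ Ψ.source) (w : E) :
    Tendsto (fun t : ℝ => Ψ.symm (Ψ x + t • w)) (𝓝[>] 0) (𝓝 x) ∧
      ∀ᶠ t : ℝ in 𝓝[>] 0, Ψ (Ψ.symm (Ψ x + t • w)) = Ψ x + t • w := by
  have h1 : Tendsto (fun t : ℝ => Ψ x + t • w) (𝓝[>] 0) (𝓝 (Ψ x)) := by
    have : Continuous fun t : ℝ => Ψ x + t • w := by fun_prop
    simpa using (this.tendsto 0).mono_left nhdsWithin_le_nhds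
  have h2 := (Ψ.continuousAt_symm (Ψ.map_source hx)).tendsto
  rw [Ψ.left_inv hx] at h2
  refine ⟨h2.comp h1, ?_⟩
  filter_upwards [h1.eventually (Ψ.open_target.mem_nhds (Ψ.map_source hx))] with t ht
    using Ψ.right_inv ht

/-! ### A covering member as one side of its wall -/

section Sheets

variable {n : ℕ} {Y : Type*} [TopologicalSpace Y] [ChartedSpace (EuclideanQuadrant n) Y]

theorem eventually_pos_of_notMem_vanishingCoords (p : Y) :
    ∀ᶠ x in 𝓝 (extChartAt (𝓒 n) p p), ∀ i, i ∉ vanishingCoords n p → 0 < x i := by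
  refine eventually_all.2 fun i => ?_
  by_cases hi : i ∈ vanishingCoords n p
  · simp [hi]
  have h1 : 0 < extChartAt (𝓒 n) p p i :=
    lt_of_le_of_ne (extChartAt_nonneg (mem_extChartAt_source p) i) fun h => hi h.symm
  filter_upwards [(PiLp.continuous_apply 2 _ i).continuousAt.eventually (lt_mem_nhds h1)]
    with x hx _ using hx

/-- Near a point of its frontier, a member of a regular covering is the positive side of the sheet
of its wall. -/
theorem IsRegularCovering.eventually_mem_iff_pos [IsManifold (𝓒 n) ∞ Y] {J : Type*}
    {U : J → Set Y} (hU : IsRegularCovering n U) {j : J} {p : Y}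
    (hp : p ∈ frontier (U j)) (c : CornerChart n (closure (U j)) p) {a : Fin n}
    (ha : wallSheets n (U j) p c = {a})
    (hind : LinearIndependent ℝ (Sum.elim
      (fun i : vanishingCoords n p =>
        (EuclideanSpace.proj (i : Fin n) : EuclideanSpace ℝ (Fin n) →L[ℝ] ℝ))
      (fun _ : Unit => c.conormal a))) :
    ∀ᶠ q in 𝓝 p, q ∈ U j ↔ 0 < c.e (extChartAt (𝓒 n) p q) a := by
  set φ := extChartAt (𝓒 n) p with hφ
  have hs : p ∈ φ.source := mem_extChartAt_source (I := 𝓒 n) p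
  have haf : a ∈ c.faces := (ha.symm ▸ rfl : a ∈ wallSheets n (U j) p c).1
  -- Faces other than `a` are not wall sheets, so near `p` they carry no frontier points in the
  -- interior of `Y`.
  have hother : ∀ᶠ x in 𝓝 (φ p), (∀ i, 0 ≤ x i) → x ∈ φ.target ∧ ∀ a' ∈ c.faces, a' ≠ a →
      ¬ (φ.symm x ∈ frontier (U j) ∩ (𝓒 n).interior Y ∧ φ.symm x ∈ φ.source ∧
        c.e (φ (φ.symm x)) a' = 0) := by
    refine (eventually_extChartAt_symm_iff hs (P := fun q => ∀ a' ∈ c.faces, a' ≠ a →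
      ¬ (q ∈ frontier (U j) ∩ (𝓒 n).interior Y ∧ q ∈ φ.source ∧ c.e (φ q) a' = 0))).2 ?_
    refine (Finset.eventually_all _).2 fun a' ha' => ?_
    by_cases h : a' = a
    · simp [h]
    have h1 : a' ∉ wallSheets n (U j) p c := by rw [ha]; exact h
    have h2 := fun h3 => h1 ⟨ha', h3⟩
    rw [mem_closure_iff_frequently] at h2
    have h2 := not_frequently.1 h2
    filter_upwards [h2] with q hq _ using hq
  have hnv := eventually_pos_of_notMem_vanishingCoords (n := n) p
  obtain ⟨O, hO, hOo, hpO⟩ := eventually_nhds_iff.1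
    (c.eventually_mem_iff.and (hother.and (hnv.and c.source_mem_nhds)))
  obtain ⟨σ, Ψ, hσ, hpΨ, hΨO, hΨ0, hΨs, hΨt, hΨσ⟩ := exists_straightening
    (f := Sum.elim (fun (i : vanishingCoords n p) (x : EuclideanSpace ℝ (Fin n)) => x i)
      (fun (_ : Unit) x => c.e x a)) (hOo.mem_nhds hpO)
    (by
      rintro (i | _)
      · exact (contDiff_euclidean.1 contDiff_id (i : Fin n)).contDiffOn
      · exact (c.contDiffOn_apply a).mono fun x hx => (hO x hx).2.2.2)
    (by
      rintro (i | _)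
      · exact i.2
      · change c.e (φ p) a = 0
        rw [c.map_base]; rfl)
    (by
      convert hind using 1
      funext k
      rcases k with i | _
      · exact (EuclideanSpace.proj (i : Fin n) : EuclideanSpace ℝ (Fin n) →L[ℝ] ℝ).fderiv
      · exact (c.conormal_eq_fderiv a).symm)
  have hΨi : ∀ (i : vanishingCoords n p) x, Ψ x (σ (Sum.inl i)) = x i := fun i x => hΨσ _ x
  have hΨa : ∀ x, Ψ x (σ (Sum.inr ())) = c.e x a := fun x => hΨσ _ x
  obtain ⟨r, hr, hrt⟩ := exists_openCube_subset
    (Ψ.open_target.mem_nhds (hΨ0 ▸ Ψ.map_source hpΨ))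
  set G := Ψ.source ∩ Ψ ⁻¹' openCube n r with hG
  have hGo : IsOpen G := Ψ.isOpen_inter_preimage (isOpen_openCube n r)
  have hpG : φ p ∈ G := ⟨hpΨ, by
    rw [mem_preimage, hΨ0]; exact zero_mem_openCube hr⟩
  have hGO : ∀ x ∈ G, x ∈ O := fun x hx => hΨO hx.1
  have hQ : ∀ x ∈ G, (∀ i : vanishingCoords n p, 0 ≤ x i) → ∀ i, 0 ≤ x i := fun x hx h i => by
    by_cases hi : i ∈ vanishingCoords n p
    · exact h ⟨i, hi⟩
    · exact ((hO x (hGO x hx)).2.2.1 i hi).le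
  have hQ' : ∀ x ∈ G, (∀ i : vanishingCoords n p, 0 < x i) → ∀ i, 0 < x i := fun x hx h i => by
    by_cases hi : i ∈ vanishingCoords n p
    · exact h ⟨i, hi⟩
    · exact (hO x (hGO x hx)).2.2.1 i hi
  have htar : ∀ x ∈ G, (∀ i, 0 ≤ x i) → x ∈ φ.target := fun x hx h =>
    ((hO x (hGO x hx)).2.1 h).1
  have hnear : ∀ x ∈ φ.target, ∀ {P : Y → Prop}, (∀ᶠ q in 𝓝 (φ.symm x), P q) →
      ∀ᶠ y in 𝓝 x, (∀ i, 0 ≤ y i) → y ∈ φ.target ∧ P (φ.symm y) := fun x hx P h => by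
    have := (eventually_extChartAt_symm_iff (φ.map_target hx)).2 h
    rwa [φ.right_inv hx] at this
  -- A face coordinate vanishing at such a point would become negative nearby, still inside the open
  -- set `U j`.
  have hmemU : ∀ x ∈ G, (∀ i, 0 < x i) → φ.symm x ∈ U j → ∀ b ∈ c.faces, 0 < c.e x b := by
    intro x hx hpos hxU b hb
    have hxt := htar x hx fun i => (hpos i).le
    have h0 := (hO x (hGO x hx)).1.1 ⟨hxt, subset_closure hxU⟩ b hb
    refine lt_of_le_of_ne h0 fun h => ?_
    refine c.frequently_neg b (hO x (hGO x hx)).2.2.2 h.ge ?_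
    have hopen : ∀ᶠ y in 𝓝 x, ∀ i, 0 < y i := eventually_all.2 fun i =>
      (PiLp.continuous_apply 2 _ i).continuousAt.eventually (lt_mem_nhds (hpos i))
    filter_upwards [hnear x hxt (eventually_mem_set.2 ((hU.isOpen j).mem_nhds hxU)), hopen, hGo.mem_nhds hx]
      with y hy hypos hyG
    obtain ⟨hyt, hyU⟩ := hy fun i => (hypos i).le
    exact not_lt.2 ((hO y (hGO y hyG)).1.1 ⟨hyt, subset_closure hyU⟩ b hb)
  have hstrict : ∀ x ∈ G, (∀ i, 0 < x i) → 0 < c.e x a → (∀ b ∈ c.faces, 0 ≤ c.e x b) →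
      ∀ b ∈ c.faces, 0 < c.e x b := by
    intro x hx hpos hxa hfaces
    obtain ⟨hxt, hxcl⟩ := (hO x (hGO x hx)).1.2 hfaces
    by_cases hxU : φ.symm x ∈ U j
    · exact hmemU x hx hpos hxU
    intro b hb
    refine lt_of_le_of_ne (hfaces b hb) fun h => ?_
    refine ((hO x (hGO x hx)).2.1 fun i => (hpos i).le).2 b hb (fun hba => ?_) ⟨⟨?_, ?_⟩, ?_, ?_⟩
    · rw [hba] at h; exact hxa.ne h
    · rw [(hU.isOpen j).frontier_eq]; exact ⟨hxcl, hxU⟩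
    · rw [mem_interior_iff_extChartAt (φ.map_target hxt), φ.right_inv hxt]
      exact hpos
    · exact φ.map_target hxt
    · rw [φ.right_inv hxt]; exact h.symm
  -- The interior points with positive `a`-coordinate form a convex set in the coordinates `Ψ`. By
  -- `hstrict` it is covered by the disjoint open sets "all face coordinates positive" and "some
  -- face coordinate negative". It meets the former because `U j` accumulates at `p`, so it lies
  -- there entirely.
  have hfill : ∀ x ∈ G, (∀ i, 0 < x i) → 0 < c.e x a → ∀ b ∈ c.faces, 0 < c.e x b := by
    let D : Set (EuclideanSpace ℝ (Fin n)) := openCube n r ∩ {y | ∀ k, 0 < y (σ k)}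
    have hDc : Convex ℝ D := by
      refine (convex_openCube n r).inter fun x hx y hy s t hs ht hst k => ?_
      have h := convex_Ioi (0 : ℝ) (x := x (σ k)) (hx k) (y := y (σ k)) (hy k) hs ht hst
      simpa using h
    have hDpre : IsPreconnected (Ψ.symm '' D) :=
      hDc.isPreconnected.image _ (Ψ.continuousOn_symm.mono fun y hy => hrt hy.1)
    have hmem : ∀ x, x ∈ Ψ.symm '' D ↔ x ∈ G ∧ (∀ i, 0 < x i) ∧ 0 < c.e x a := by
      intro x
      constructor
      · rintro ⟨y, hy, rfl⟩
        have hyt := hrt hy.1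
        have hxG : Ψ.symm y ∈ G := ⟨Ψ.map_target hyt, by
          rw [mem_preimage, Ψ.right_inv hyt]; exact hy.1⟩
        refine ⟨hxG, hQ' _ hxG fun i => ?_, ?_⟩
        · rw [← hΨi, Ψ.right_inv hyt]; exact hy.2 _
        · rw [← hΨa, Ψ.right_inv hyt]; exact hy.2 _
      · rintro ⟨hxG, hpos, hxa⟩
        refine ⟨Ψ x, ⟨hxG.2, ?_⟩, Ψ.left_inv hxG.1⟩
        rintro (i | u)
        · rw [hΨi]; exact hpos _
        · rw [hΨa]; exact hxa
    let u := c.e.source ∩ c.e ⁻¹' {y | ∀ b ∈ c.faces, 0 < y b}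
    let v := c.e.source ∩ c.e ⁻¹' {y | ∃ b ∈ c.faces, y b < 0}
    have hu : IsOpen u := by
      refine c.e.isOpen_inter_preimage ?_
      simp only [ofPred_forall]
      exact isOpen_biInter_finset fun b _ =>
        isOpen_lt continuous_const (PiLp.continuous_apply 2 _ b)
    have hv : IsOpen v := by
      refine c.e.isOpen_inter_preimage ?_
      simp only [← exists_prop, ofPred_exists]
      exact isOpen_biUnion fun b _ => isOpen_lt (PiLp.continuous_apply 2 _ b) continuous_const
    have huv : Disjoint u v := disjoint_left.2 fun x hxu ⟨_, b, hb, hxb⟩ =>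
      lt_asymm (hxu.2 b hb) hxb
    have hcov : Ψ.symm '' D ⊆ u ∪ v := by
      intro x hx
      obtain ⟨hxG, hpos, hxa⟩ := (hmem x).1 hx
      by_cases h : ∃ b ∈ c.faces, c.e x b < 0
      · exact Or.inr ⟨(hO x (hGO x hxG)).2.2.2, h⟩
      · push Not at h
        exact Or.inl ⟨(hO x (hGO x hxG)).2.2.2, hstrict x hxG hpos hxa h⟩
    have hne : (Ψ.symm '' D ∩ u).Nonempty := by
      have h1 : ∀ᶠ q in 𝓝 p, q ∈ φ.source ∧ φ q ∈ G :=
        (eventually_mem_set.2 (extChartAt_source_mem_nhds (I := 𝓒 n) p)).and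
          ((continuousAt_extChartAt (I := 𝓒 n) p).eventually_mem (hGo.mem_nhds hpG))
      have h2 : ∃ᶠ q in 𝓝 p, q ∈ U j := mem_closure_iff_frequently.1 (frontier_subset_closure hp)
      obtain ⟨q, hqU, hq1⟩ := (h2.and_eventually h1.eventually_nhds).exists
      obtain ⟨q', hq'i, hq'U, hq's, hq'G⟩ := ((frequently_mem_interior (n := n) q).and_eventually
        ((eventually_mem_set.2 ((hU.isOpen j).mem_nhds hqU)).and hq1)).exists
      have hpos := (mem_interior_iff_extChartAt hq's).1 hq'i
      have hf := hmemU (φ q') hq'G hpos (by rw [φ.left_inv hq's]; exact hq'U)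
      exact ⟨φ q', (hmem _).2 ⟨hq'G, hpos, hf a haf⟩, (hO _ (hGO _ hq'G)).2.2.2, hf⟩
    intro x hx hpos hxa
    exact (hDpre.subset_left_of_subset_union hu hv huv hcov hne ((hmem x).2 ⟨hx, hpos, hxa⟩)).2
  have hcl : ∀ x ∈ G, (∀ i, 0 ≤ x i) → 0 < c.e x a → φ.symm x ∈ closure (U j) := by
    intro x hx hpos hxa
    refine ((hO x (hGO x hx)).1.2 fun b hb => ?_).2
    -- Points of `∂Y` are limits of interior points, reached by increasing every coordinate of `Ψ`.
    obtain ⟨hlim, hΨt⟩ := Ψ.tendsto_symm_add_smul hx.1 (WithLp.toLp 2 fun _ => (1 : ℝ))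
    have hcb := ((PiLp.continuous_apply 2 (fun _ : Fin n => ℝ) b).continuousAt.comp
      (c.e.continuousAt (hO x (hGO x hx)).2.2.2)).tendsto.comp hlim
    refine ge_of_tendsto hcb ?_
    filter_upwards [hΨt, hlim.eventually_mem (hGo.mem_nhds hx), self_mem_nhdsWithin] with t ht htG ht0
    have ht0' : (0 : ℝ) < t := ht0
    refine (hfill _ htG (hQ' _ htG fun i => ?_) ?_ b hb).le
    · rw [← hΨi, ht]
      simp only [PiLp.add_apply, PiLp.smul_apply, smul_eq_mul, mul_one, hΨi]
      linarith [hpos i]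
    · rw [← hΨa, ht]
      simp only [PiLp.add_apply, PiLp.smul_apply, smul_eq_mul, mul_one, hΨa]
      linarith
  filter_upwards [extChartAt_source_mem_nhds (I := 𝓒 n) p,
    (continuousAt_extChartAt (I := 𝓒 n) p).eventually_mem (hGo.mem_nhds hpG)] with q hqs hqG
  have hqQ : ∀ i, 0 ≤ φ q i := extChartAt_nonneg hqs
  constructor
  · intro hqU
    have h0 : 0 ≤ c.e (φ q) a := (hO _ (hGO _ hqG)).1.1
      ⟨φ.map_source hqs, by rw [φ.left_inv hqs]; exact subset_closure hqU⟩ a haf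
    refine lt_of_le_of_ne h0 fun h => ?_
    -- Lowering only the wall coordinate keeps the boundary coordinates nonnegative, so the moved
    -- point stays in `Y` and in `U j`, yet its `a`-coordinate is negative.
    obtain ⟨hlim, hΨt⟩ := Ψ.tendsto_symm_add_smul hqG.1
      (-EuclideanSpace.single (σ (Sum.inr ())) (1 : ℝ))
    have hn := (eventually_extChartAt_symm_iff hqs).2
      (eventually_mem_set.2 ((hU.isOpen j).mem_nhds hqU))
    obtain ⟨t, ht, htG, ht0, htn⟩ := (hΨt.and ((hlim.eventually_mem (hGo.mem_nhds hqG)).and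
      (Filter.Eventually.and self_mem_nhdsWithin (hlim.eventually hn)))).exists
    have ht0' : (0 : ℝ) < t := ht0
    obtain ⟨h1, h2⟩ := htn (hQ _ htG fun i => by
      have hne : σ (Sum.inl i) ≠ σ (Sum.inr ()) := fun h => by simpa using hσ h
      rw [← hΨi, ht]
      simp only [PiLp.add_apply, PiLp.smul_apply, PiLp.neg_apply, PiLp.single_apply, if_neg hne,
        hΨi, neg_zero, smul_zero, add_zero]
      exact hqQ i)
    have h3 := (hO _ (hGO _ htG)).1.1 ⟨h1, subset_closure h2⟩ a haf
    rw [← hΨa, ht] at h3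
    simp only [PiLp.add_apply, PiLp.smul_apply, PiLp.neg_apply, PiLp.single_apply,
      if_true, hΨa, smul_eq_mul] at h3
    linarith
  · intro hqa
    have hgood : ∀ᶠ q' in 𝓝 q, q' ∈ φ.source ∧ φ q' ∈ G ∧ 0 < c.e (φ q') a := by
      have h1 := continuousAt_extChartAt' (I := 𝓒 n) hqs
      have h2 := (PiLp.continuous_apply 2 (fun _ : Fin n => ℝ) a).continuousAt.comp
        (c.e.continuousAt (hO _ (hGO _ hqG)).2.2.2)
      exact (eventually_mem_set.2 (extChartAt_source_mem_nhds' (I := 𝓒 n) hqs)).and ((h1.eventually_mem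
        (hGo.mem_nhds hqG)).and (h1.eventually (h2.eventually (lt_mem_nhds hqa))))
    have hgcl : ∀ᶠ q' in 𝓝 q, q' ∈ closure (U j) := by
      filter_upwards [hgood] with q' hq'
      have := hcl _ hq'.2.1 (extChartAt_nonneg hq'.1) hq'.2.2
      rwa [φ.left_inv hq'.1] at this
    -- Otherwise `q` is a frontier point, hence a limit of frontier points in the interior of `Y`,
    -- and `closure (U j)` is a neighbourhood of those close to `q`.
    by_contra hqU
    have hqf : q ∈ frontier (U j) := by
      rw [(hU.isOpen j).frontier_eq]; exact ⟨hgcl.self_of_nhds, hqU⟩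
    obtain ⟨q', hq'f, hq'c⟩ := ((mem_closure_iff_frequently.1
      (hU.frontier_subset_wall j hqf)).and_eventually hgcl.eventually_nhds).exists
    exact hU.closure_notMem_nhds hq'f.1 hq'f.2 hq'c

end Sheets

/-! ### Coordinates adapted to all walls at once -/

section AdaptedCharts

variable {n : ℕ} {Y : Type*} [TopologicalSpace Y] [ChartedSpace (EuclideanQuadrant n) Y]
  {J : Type*}

/-- A coordinate system centred at `p` in which the hypersurfaces of `∂Y` and the walls through `p`
are coordinate hypersurfaces. -/
structure AdaptedChart (U : J → Set Y) (p : Y) (N : Set Y) where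
  /-- the change of coordinates -/
  Ψ : OpenPartialHomeomorph (EuclideanSpace ℝ (Fin n)) (EuclideanSpace ℝ (Fin n))
  /-- the coordinates that cut out the hypersurfaces of `∂Y` -/
  L : Finset (Fin n)
  /-- the coordinates that cut out the walls -/
  κ : {j : J // p ∈ frontier (U j)} → Fin n
  /-- the size of the coordinate cube -/
  r : ℝ
  κ_injective : Function.Injective κ
  κ_notMem : ∀ j, κ j ∉ L
  card_L : L.card = cornerDepth n p
  r_pos : 0 < r
  mem_source : extChartAt (𝓒 n) p p ∈ Ψ.source
  map_base : Ψ (extChartAt (𝓒 n) p p) = 0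
  contDiffOn_Ψ : ContDiffOn ℝ ∞ Ψ Ψ.source
  contDiffOn_symm : ContDiffOn ℝ ∞ Ψ.symm Ψ.target
  target_eq : Ψ.target = openCube n r
  mem_target_iff : ∀ x ∈ Ψ.source, x ∈ (extChartAt (𝓒 n) p).target ↔ ∀ i ∈ L, 0 ≤ Ψ x i
  mem_nhd : ∀ q ∈ (extChartAt (𝓒 n) p).source, extChartAt (𝓒 n) p q ∈ Ψ.source → q ∈ N
  mem_iff_pos : ∀ q ∈ (extChartAt (𝓒 n) p).source, extChartAt (𝓒 n) p q ∈ Ψ.source →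
    ∀ j : {j : J // p ∈ frontier (U j)}, q ∈ U j ↔ 0 < Ψ (extChartAt (𝓒 n) p q) (κ j)
  mem_iff_mem : ∀ q ∈ (extChartAt (𝓒 n) p).source, extChartAt (𝓒 n) p q ∈ Ψ.source →
    ∀ j, p ∉ frontier (U j) → (q ∈ U j ↔ p ∈ U j)

theorem IsRegularCovering.nonempty_adaptedChart [IsManifold (𝓒 n) ∞ Y] [Finite J]
    {U : J → Set Y} (hU : IsRegularCovering n U) {p : Y} {N : Set Y} (hN : N ∈ 𝓝 p) :
    Nonempty (AdaptedChart (n := n) U p N) := by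
  classical
  have hwall : ∀ j : {j : J // p ∈ wall n (U j)}, Nonempty (CornerChart n (closure (U j)) p) :=
    fun j => by
      have hb : p ∈ cornerBoundary n (closure (U j)) := hU.boundary_eq j ▸ Or.inl j.2
      obtain ⟨-, k, -, c, -⟩ := hb
      exact ⟨c⟩
  let c := fun j => (hwall j).some
  have hind := hU.transverse p c
  let ν : {j : J // p ∈ frontier (U j)} → {j : J // p ∈ wall n (U j)} := fun j =>
    ⟨j, hU.frontier_subset_wall j j.2⟩
  have hsheet : ∀ j : {j : J // p ∈ frontier (U j)}, ∃ a, wallSheets n (U j) p (c (ν j)) = {a} := fun j => by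
    refine hU.exists_wallSheets_eq_singleton j.2 _ ?_
    convert hind.comp (Sum.map id (Sigma.mk (ν j)))
      (Function.Injective.sumMap Function.injective_id sigma_mk_injective) using 1
    funext k
    rcases k with i | a <;> rfl
  choose a ha using hsheet
  have hmem : ∀ j : {j : J // p ∈ frontier (U j)}, a j ∈ wallSheets n (U j) p (c (ν j)) := fun j => by
    rw [ha]; rfl
  -- Each frontier index contributes its one sheet. Independence passes to this subfamily because
  -- `τ` is injective.
  let τ : {j : J // p ∈ frontier (U j)} →
      (j : {j : J // p ∈ wall n (U j)}) × wallSheets n (U j) p (c j) :=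
    fun j => ⟨ν j, a j, hmem j⟩
  have hτ : Function.Injective τ := fun j j' h => by
    have h1 := congrArg (fun s => (s.1 : J)) h
    exact Subtype.ext h1
  have hpos : ∀ᶠ q in 𝓝 p, ∀ j : {j : J // p ∈ frontier (U j)}, q ∈ U j ↔
      0 < (c (ν j)).e (extChartAt (𝓒 n) p q) (a j) := eventually_all.2 fun j => by
    refine hU.eventually_mem_iff_pos j.2 _ (ha j) ?_
    convert hind.comp (Sum.map id (fun _ : Unit => τ j))
      (Function.Injective.sumMap Function.injective_id fun _ _ _ => rfl) using 1
    funext k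
    rcases k with i | a <;> rfl
  have hconst : ∀ᶠ q in 𝓝 p, ∀ j, p ∉ frontier (U j) → (q ∈ U j ↔ p ∈ U j) :=
    eventually_all.2 fun j => by
      by_cases hj : p ∈ U j
      · filter_upwards [(hU.isOpen j).mem_nhds hj] with q hq _ using iff_of_true hq hj
      by_cases hj' : p ∈ closure (U j)
      · refine Eventually.of_forall fun q h => (h ?_).elim
        rw [(hU.isOpen j).frontier_eq]; exact ⟨hj', hj⟩
      · filter_upwards [isClosed_closure.isOpen_compl.mem_nhds hj'] with q hq _
        exact iff_of_false (fun h => hq (subset_closure h)) hj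
  have hsrc : ∀ᶠ x in 𝓝 (extChartAt (𝓒 n) p p), ∀ j, x ∈ (c (ν j)).e.source :=
    eventually_all.2 fun j => eventually_mem_set.2 (c (ν j)).source_mem_nhds
  have hs := mem_extChartAt_source (I := 𝓒 n) p
  obtain ⟨O, hO, hOo, hpO⟩ := eventually_nhds_iff.1
    (((eventually_extChartAt_symm_iff hs).2 ((eventually_mem_set.2 hN).and
      (hpos.and hconst))).and ((eventually_pos_of_notMem_vanishingCoords (n := n) p).and hsrc))
  obtain ⟨σ, Ψ, hσ, hpΨ, hΨO, hΨ0, hΨs, hΨt, hΨσ⟩ := exists_straightening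
    (f := Sum.elim (fun (i : vanishingCoords n p) (x : EuclideanSpace ℝ (Fin n)) => x i)
      (fun j x => (c (ν j)).e x (a j))) (hOo.mem_nhds hpO)
    (by
      rintro (i | j)
      · exact (contDiff_euclidean.1 contDiff_id (i : Fin n)).contDiffOn
      · exact ((c (ν j)).contDiffOn_apply (a j)).mono fun x hx => (hO x hx).2.2 j)
    (by
      rintro (i | j)
      · exact i.2
      · change (c (ν j)).e (extChartAt (𝓒 n) p p) (a j) = 0
        rw [(c (ν j)).map_base]; rfl)
    (by
      convert hind.comp (Sum.map id τ)
        (Function.Injective.sumMap Function.injective_id hτ) using 1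
      funext k
      rcases k with i | j
      · exact (EuclideanSpace.proj (i : Fin n) : EuclideanSpace ℝ (Fin n) →L[ℝ] ℝ).fderiv
      · exact ((c (ν j)).conormal_eq_fderiv (a j)).symm)
  obtain ⟨r, hr, hrt⟩ := exists_openCube_subset
    (Ψ.open_target.mem_nhds (hΨ0 ▸ Ψ.map_source hpΨ))
  have : Fintype (vanishingCoords n p) := Fintype.ofFinite _
  -- Restricting the inverse makes the target exactly a cube, so that quadrants in it are convex.
  let Φ := (Ψ.symm.restrOpen (openCube n r) (isOpen_openCube n r)).symm
  have hΦs : ∀ x ∈ Φ.source, x ∈ Ψ.source ∧ Ψ x ∈ openCube n r := fun x hx => by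
    have h1 := Φ.map_source hx
    refine ⟨?_, h1.2⟩
    have h2 := Ψ.map_target h1.1
    have h3 : Ψ.symm (Φ x) = x := Φ.left_inv hx
    rwa [h3] at h2
  have hΦt : Φ.target = openCube n r := by
    change Ψ.target ∩ openCube n r = _
    exact inter_eq_right.2 hrt
  have hp : extChartAt (𝓒 n) p p ∈ Φ.source := by
    have h1 : (0 : EuclideanSpace ℝ (Fin n)) ∈ Φ.target := hΦt ▸ zero_mem_openCube hr
    have h2 := Φ.map_target h1
    have h3 : Φ.symm 0 = extChartAt (𝓒 n) p p := by
      change Ψ.symm 0 = _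
      rw [← hΨ0, Ψ.left_inv hpΨ]
    rwa [h3] at h2
  have hmain : ∀ q ∈ (extChartAt (𝓒 n) p).source, extChartAt (𝓒 n) p q ∈ Φ.source →
      q ∈ N ∧ (∀ j : {j : J // p ∈ frontier (U j)}, q ∈ U j ↔ 0 < (c (ν j)).e (extChartAt (𝓒 n) p q) (a j)) ∧
        ∀ j, p ∉ frontier (U j) → (q ∈ U j ↔ p ∈ U j) := fun q hq hqΦ => by
    have := ((hO _ (hΨO (hΦs _ hqΦ).1)).1 (extChartAt_nonneg hq)).2
    rwa [(extChartAt (𝓒 n) p).left_inv hq] at this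
  exact ⟨{
    Ψ := Φ
    L := Finset.univ.image (σ ∘ Sum.inl)
    κ := fun j => σ (Sum.inr j)
    r := r
    κ_injective := hσ.comp Sum.inr_injective
    κ_notMem := fun j hj => by
      obtain ⟨i, -, hi⟩ := Finset.mem_image.1 hj
      exact Sum.inl_ne_inr (hσ hi)
    card_L := by
      rw [Finset.card_image_of_injective _ (hσ.comp Sum.inl_injective), Finset.card_univ,
        cornerDepth, ncard_eq_toFinset_card', toFinset_card]
    r_pos := hr
    mem_source := hp
    map_base := hΨ0
    contDiffOn_Ψ := hΨs.mono fun x hx => (hΦs x hx).1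
    contDiffOn_symm := hΨt.mono fun y hy => hy.1
    target_eq := hΦt
    mem_target_iff := fun x hx => by
      have hxO := hO x (hΨO (hΦs x hx).1)
      constructor
      · intro h i hi
        obtain ⟨i, -, rfl⟩ := Finset.mem_image.1 hi
        exact (extChartAt_target_nonneg h i).trans_eq (hΨσ (Sum.inl i) x).symm
      · intro h
        refine (hxO.1 fun i => ?_).1
        by_cases hi : i ∈ vanishingCoords n p
        · have h1 := h _ (Finset.mem_image_of_mem _ (Finset.mem_univ ⟨i, hi⟩))
          exact h1.trans_eq (hΨσ (Sum.inl ⟨i, hi⟩) x)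
        · exact (hxO.2.1 i hi).le
    mem_nhd := fun q hq hqΦ => (hmain q hq hqΦ).1
    mem_iff_pos := fun q hq hqΦ j => by
      rw [(hmain q hq hqΦ).2.1 j]
      exact (hΨσ (Sum.inr j) _).symm ▸ Iff.rfl
    mem_iff_mem := fun q hq hqΦ => (hmain q hq hqΦ).2.2 }⟩

end AdaptedCharts

/-! ### Closed level sets as coordinate quadrants -/

theorem isClosed_signQuadrant {n : ℕ} (K s : Finset (Fin n)) : IsClosed (signQuadrant n K s) := by
  simp only [signQuadrant, ofPred_forall, ofPred_and]
  exact isClosed_biInter fun i _ =>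
    (isClosed_iInter fun _ => isClosed_le continuous_const (PiLp.continuous_apply 2 _ i)).inter
      (isClosed_iInter fun _ => isClosed_le (PiLp.continuous_apply 2 _ i) continuous_const)

theorem convex_signQuadrant {n : ℕ} (K s : Finset (Fin n)) : Convex ℝ (signQuadrant n K s) := by
  intro x hx y hy a b ha hb hab i hi
  simp only [PiLp.add_apply, PiLp.smul_apply, smul_eq_mul]
  refine ⟨fun his => ?_, fun his => ?_⟩
  · have h1 := (hx i hi).1 his
    have h2 := (hy i hi).1 his
    positivity
  · have h1 := mul_nonneg ha (neg_nonneg.2 ((hx i hi).2 his))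
    have h2 := mul_nonneg hb (neg_nonneg.2 ((hy i hi).2 his))
    linarith

theorem zero_mem_signQuadrant {n : ℕ} (K s : Finset (Fin n)) : 0 ∈ signQuadrant n K s :=
  fun _ _ => ⟨fun _ => le_rfl, fun _ => le_rfl⟩

namespace AdaptedChart

variable {n : ℕ} {Y : Type*} [TopologicalSpace Y] [ChartedSpace (EuclideanQuadrant n) Y]
  {J : Type*} {U : J → Set Y} {p : Y} {N : Set Y} (A : AdaptedChart (n := n) U p N)

/-- The coordinate map of an adapted chart, defined on an open subset of the manifold. -/
noncomputable def ψ : PartialEquiv Y (EuclideanSpace ℝ (Fin n)) :=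
  (extChartAt (𝓒 n) p).trans A.Ψ.toPartialEquiv

theorem mem_ψ_source {q : Y} : q ∈ A.ψ.source ↔
    q ∈ (extChartAt (𝓒 n) p).source ∧ extChartAt (𝓒 n) p q ∈ A.Ψ.source := Iff.rfl

theorem mem_ψ_target {y : EuclideanSpace ℝ (Fin n)} : y ∈ A.ψ.target ↔
    y ∈ A.Ψ.target ∧ A.Ψ.symm y ∈ (extChartAt (𝓒 n) p).target := Iff.rfl

theorem ψ_target_eq : A.ψ.target = openCube n A.r ∩ {y | ∀ i ∈ A.L, 0 ≤ y i} := by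
  ext y
  rw [mem_ψ_target, ← A.target_eq]
  refine and_congr_right fun hy => ?_
  rw [A.mem_target_iff _ (A.Ψ.map_target hy), A.Ψ.right_inv hy]
  rfl

theorem isOpen_ψ_source : IsOpen A.ψ.source :=
  (continuousOn_extChartAt p).isOpen_inter_preimage (isOpen_extChartAt_source p) A.Ψ.open_source

theorem base_mem_ψ_source : p ∈ A.ψ.source := ⟨mem_extChartAt_source p, A.mem_source⟩

theorem ψ_base : A.ψ p = 0 := A.map_base

theorem contMDiffOn_ψ [IsManifold (𝓒 n) ∞ Y] : ContMDiffOn (𝓒 n) (𝓡 n) ∞ A.ψ A.ψ.source := by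
  refine A.contDiffOn_Ψ.contMDiffOn.comp
    ((contMDiffOn_extChartAt (I := 𝓒 n) (n := ∞) (x := p)).mono fun q hq => ?_) fun q hq => hq.2
  rw [← extChartAt_source (𝓒 n)]
  exact hq.1

theorem contMDiffOn_ψ_symm [IsManifold (𝓒 n) ∞ Y] :
    ContMDiffOn (𝓡 n) (𝓒 n) ∞ A.ψ.symm A.ψ.target :=
  (contMDiffOn_extChartAt_symm (I := 𝓒 n) (n := ∞) p).comp
    (A.contDiffOn_symm.contMDiffOn.mono fun _ hy => hy.1) fun _ hy => hy.2

theorem continuousOn_ψ : ContinuousOn A.ψ A.ψ.source :=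
  A.Ψ.continuousOn.comp ((continuousOn_extChartAt (I := 𝓒 n) p).mono
    (fun _ hq => hq.1 : A.ψ.source ⊆ _)) fun _ hq => hq.2

theorem continuousOn_ψ_symm : ContinuousOn A.ψ.symm A.ψ.target :=
  (continuousOn_extChartAt_symm p).comp
    (A.Ψ.continuousOn_symm.mono fun _ hy => hy.1) fun _ hy => hy.2

/-- The set of members of the covering that contain the points whose positive wall coordinates are
those in `s`. -/
def typeOf (s : Finset (Fin n)) : Set J := {j | p ∈ U j ∨ ∃ h : p ∈ frontier (U j), A.κ ⟨j, h⟩ ∈ s}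

variable [Finite J]

/-- The coordinates that cut out the walls. -/
noncomputable def K : Finset (Fin n) := (finite_range A.κ).toFinset

theorem mem_K {m : Fin n} : m ∈ A.K ↔ ∃ j, A.κ j = m := by simp [K]

theorem disjoint_L_K : Disjoint A.L A.K := by
  rw [Finset.disjoint_right]
  intro m hm
  obtain ⟨j, rfl⟩ := A.mem_K.1 hm
  exact A.κ_notMem j

/-- Frontier indices are decided by signs and all others by `p`. The two alternatives in `typeOf`
never clash, because an open set misses its frontier. -/
theorem coveringType_eq_iff (hU : ∀ j, IsOpen (U j)) {q : Y} (hq : q ∈ A.ψ.source)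
    (s : Finset (Fin n)) :
    coveringType U q = A.typeOf s ↔ ∀ m ∈ A.K, (0 < A.ψ q m ↔ m ∈ s) := by
  have hnot : ∀ j, p ∈ frontier (U j) → p ∉ U j := fun j hj h => by
    rw [(hU j).frontier_eq] at hj
    exact hj.2 h
  constructor
  · intro h m hm
    obtain ⟨⟨j, hj⟩, rfl⟩ := A.mem_K.1 hm
    have h1 : j ∈ coveringType U q ↔ j ∈ A.typeOf s := by rw [h]
    refine (A.mem_iff_pos q hq.1 hq.2 ⟨j, hj⟩).symm.trans (h1.trans ⟨?_, fun h => Or.inr ⟨hj, h⟩⟩)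
    rintro (h2 | ⟨_, h2⟩)
    · exact (hnot j hj h2).elim
    · exact h2
  · intro h
    ext j
    by_cases hj : p ∈ frontier (U j)
    · refine (A.mem_iff_pos q hq.1 hq.2 ⟨j, hj⟩).trans ((h _ (A.mem_K.2 ⟨_, rfl⟩)).trans
        ⟨fun h => Or.inr ⟨hj, h⟩, ?_⟩)
      rintro (h2 | ⟨_, h2⟩)
      · exact (hnot j hj h2).elim
      · exact h2
    · refine (A.mem_iff_mem q hq.1 hq.2 j hj).trans ⟨Or.inl, ?_⟩
      rintro (h2 | ⟨h2, -⟩)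
      · exact h2
      · exact (hj h2).elim

theorem exists_coveringType_eq (hU : ∀ j, IsOpen (U j)) {q : Y} (hq : q ∈ A.ψ.source) :
    ∃ s ⊆ A.K, coveringType U q = A.typeOf s := by
  refine ⟨A.K.filter fun m => 0 < A.ψ q m, Finset.filter_subset _ _, ?_⟩
  rw [A.coveringType_eq_iff hU hq]
  intro m hm
  simp [hm]

/-- Near `p`, the closed level sets of the characteristic map are the coordinate quadrants. -/
theorem mem_closure_coveringType_iff (hU : ∀ j, IsOpen (U j)) {q : Y} (hq : q ∈ A.ψ.source)
    {s : Finset (Fin n)} (hs : s ⊆ A.K) :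
    q ∈ closure (coveringType U ⁻¹' {A.typeOf s}) ↔ A.ψ q ∈ signQuadrant n A.K s := by
  have hnhd := A.isOpen_ψ_source.mem_nhds hq
  constructor
  · intro h
    have h1 : ∃ᶠ q' in 𝓝 q, A.ψ q' ∈ signQuadrant n A.K s := by
      refine (mem_closure_iff_frequently.1 h).mp ?_
      filter_upwards [hnhd] with q' hq' hq't m hm
      have h2 := (A.coveringType_eq_iff hU hq' s).1 hq't m hm
      exact ⟨fun hms => (h2.2 hms).le, fun hms => not_lt.1 fun h3 => hms (h2.1 h3)⟩
    exact (isClosed_signQuadrant _ _).mem_of_frequently_of_tendsto h1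
      (A.continuousOn_ψ.continuousAt hnhd)
  · intro h
    -- This direction makes the coordinates in `s` strictly positive. The others in `K` may stay at
    -- `0`, which already counts as outside `U j`, and those in `L` do not move.
    let w : EuclideanSpace ℝ (Fin n) := WithLp.toLp 2 fun m => if m ∈ s then 1 else 0
    have hw : ∀ (t : ℝ) m, (A.ψ q + t • w) m = A.ψ q m + if m ∈ s then t else 0 := fun t m => by
      simp [w]
    have hlim : Tendsto (fun t : ℝ => A.ψ q + t • w) (𝓝[>] 0) (𝓝 (A.ψ q)) := by
      have : Continuous fun t : ℝ => A.ψ q + t • w := by fun_prop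
      simpa using (this.tendsto 0).mono_left nhdsWithin_le_nhds
    have hqt := A.ψ.map_source hq
    have hmem : ∀ᶠ t : ℝ in 𝓝[>] 0, A.ψ q + t • w ∈ A.ψ.target := by
      rw [ψ_target_eq] at hqt ⊢
      filter_upwards [hlim.eventually_mem ((isOpen_openCube n A.r).mem_nhds hqt.1)] with t ht
      refine ⟨ht, fun i hi => ?_⟩
      have his : i ∉ s := fun his => Finset.disjoint_left.1 A.disjoint_L_K hi (hs his)
      rw [hw, if_neg his, add_zero]
      exact hqt.2 i hi
    have hlim' : Tendsto (fun t : ℝ => A.ψ.symm (A.ψ q + t • w)) (𝓝[>] 0) (𝓝 q) := by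
      have h1 := (A.continuousOn_ψ_symm _ hqt).tendsto
      rw [A.ψ.left_inv hq] at h1
      exact h1.comp (tendsto_nhdsWithin_iff.2 ⟨hlim, hmem⟩)
    refine mem_closure_of_tendsto hlim' ?_
    filter_upwards [hmem, self_mem_nhdsWithin] with t ht ht0
    have ht0' : (0 : ℝ) < t := ht0
    refine (A.coveringType_eq_iff hU (A.ψ.map_target ht) s).2 fun m hm => ?_
    rw [A.ψ.right_inv ht, hw]
    by_cases hms : m ∈ s
    · have := (h m hm).1 hms
      simp only [hms, if_true, iff_true]
      linarith
    · have := (h m hm).2 hms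
      simp only [hms, if_false, add_zero, iff_false]
      linarith

theorem isPreconnected_signQuadrant (s : Finset (Fin n)) :
    IsPreconnected (A.ψ.source ∩ A.ψ ⁻¹' signQuadrant n A.K s) := by
  have hconv : Convex ℝ (A.ψ.target ∩ signQuadrant n A.K s) := by
    have hL : Convex ℝ {y : EuclideanSpace ℝ (Fin n) | ∀ i ∈ A.L, 0 ≤ y i} :=
        fun x hx y hy a b ha hb hab i hi => by
      have h1 := hx i hi
      have h2 := hy i hi
      simp only [PiLp.add_apply, PiLp.smul_apply, smul_eq_mul]
      positivity
    rw [ψ_target_eq]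
    exact ((convex_openCube n A.r).inter hL).inter (convex_signQuadrant _ _)
  rw [← A.ψ.symm_image_target_inter_eq']
  exact hconv.isPreconnected.image _ (A.continuousOn_ψ_symm.mono inter_subset_left)

theorem mem_closure_base (hU : ∀ j, IsOpen (U j)) {s : Finset (Fin n)} (hs : s ⊆ A.K) :
    p ∈ closure (coveringType U ⁻¹' {A.typeOf s}) := by
  rw [A.mem_closure_coveringType_iff hU A.base_mem_ψ_source hs, ψ_base]
  exact zero_mem_signQuadrant _ _

/-- The quadrant is connected and contained in the closed level set, so a component that meets it
contains it. -/
theorem connectedComponentIn_inter (hU : ∀ j, IsOpen (U j)) {s : Finset (Fin n)} (hs : s ⊆ A.K)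
    {b : Y} (hb : (connectedComponentIn (closure (coveringType U ⁻¹' {A.typeOf s})) b ∩
      A.ψ.source).Nonempty) :
    connectedComponentIn (closure (coveringType U ⁻¹' {A.typeOf s})) b ∩ A.ψ.source =
      A.ψ.source ∩ A.ψ ⁻¹' signQuadrant n A.K s := by
  obtain ⟨q, hqb, hq⟩ := hb
  have hsub : ∀ q' ∈ connectedComponentIn (closure (coveringType U ⁻¹' {A.typeOf s})) b,
      q' ∈ A.ψ.source → q' ∈ A.ψ.source ∩ A.ψ ⁻¹' signQuadrant n A.K s := fun q' h h' =>
    ⟨h', (A.mem_closure_coveringType_iff hU h' hs).1 (connectedComponentIn_subset _ _ h)⟩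
  refine Subset.antisymm (fun q' h => hsub q' h.1 h.2) fun q' h => ⟨?_, h.1⟩
  rw [connectedComponentIn_eq hqb]
  exact (A.isPreconnected_signQuadrant s).subset_connectedComponentIn (hsub q hqb hq)
    (fun y hy => (A.mem_closure_coveringType_iff hU hy.1 hs).2 hy.2) h

/-- Near `p`, the members of the associated partition are the coordinate quadrants. -/
theorem exists_inter_eq (hU : ∀ j, IsOpen (U j)) {B : Set Y} (hB : B ∈ associatedPartition U)
    (hne : (B ∩ A.ψ.source).Nonempty) :
    ∃ s ⊆ A.K, B ∩ A.ψ.source = A.ψ.source ∩ A.ψ ⁻¹' signQuadrant n A.K s := by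
  obtain ⟨T, b, hb, rfl⟩ := hB
  obtain ⟨q, hqb, hq⟩ := hne
  -- The point `q` is only in the closure; a nearby point of the level set itself identifies `T` as
  -- some `typeOf s`.
  obtain ⟨q', hq's, hq'T⟩ := mem_closure_iff.1 (connectedComponentIn_subset _ _ hqb) _
    A.isOpen_ψ_source hq
  obtain ⟨s, hs, hsT⟩ := A.exists_coveringType_eq hU hq's
  obtain rfl : T = A.typeOf s := hq'T.symm.trans hsT
  exact ⟨s, hs, A.connectedComponentIn_inter hU hs ⟨q, hqb, hq⟩⟩

/-- The families of members of the partition and of quadrants agree near `p`. -/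
theorem setOf_inter_eq (hU : ∀ j, IsOpen (U j)) :
    {S | ∃ B ∈ associatedPartition U, (B ∩ A.ψ.source).Nonempty ∧ S = B ∩ A.ψ.source} =
      {S | ∃ s ⊆ A.K, S = A.ψ.source ∩ A.ψ ⁻¹' signQuadrant n A.K s} := by
  ext S
  constructor
  · rintro ⟨B, hB, hne, rfl⟩
    exact A.exists_inter_eq hU hB hne
  · rintro ⟨s, hs, rfl⟩
    -- Every quadrant contains the origin, so the component through `p` realises it.
    have hp := A.mem_closure_base hU hs
    have hne : (connectedComponentIn (closure (coveringType U ⁻¹' {A.typeOf s})) p ∩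
        A.ψ.source).Nonempty := ⟨p, mem_connectedComponentIn hp, A.base_mem_ψ_source⟩
    exact ⟨_, ⟨A.typeOf s, p, hp, rfl⟩, hne, (A.connectedComponentIn_inter hU hs hne).symm⟩

end AdaptedChart

/-! ### Corner charts of blocks and disjointness of interiors -/

/-- The linear involution of `ℝⁿ` that changes the sign of the coordinates outside `s`. -/
noncomputable def flipOutside {n : ℕ} (s : Finset (Fin n)) :
    EuclideanSpace ℝ (Fin n) ≃L[ℝ] EuclideanSpace ℝ (Fin n) :=
  let f : EuclideanSpace ℝ (Fin n) →ₗ[ℝ] EuclideanSpace ℝ (Fin n) :=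
    { toFun := fun y => WithLp.toLp 2 fun m => if m ∈ s then y m else -y m
      map_add' := fun x y => by
        ext m
        by_cases h : m ∈ s <;> simp [h, add_comm]
      map_smul' := fun a x => by
        ext m
        by_cases h : m ∈ s <;> simp [h] }
  (LinearEquiv.ofInvolutive f fun y => by
    ext m
    by_cases h : m ∈ s <;> simp [f, h]).toContinuousLinearEquiv

theorem flipOutside_apply {n : ℕ} (s : Finset (Fin n)) (y : EuclideanSpace ℝ (Fin n)) (m : Fin n) :
    flipOutside s y m = if m ∈ s then y m else -y m := rfl

section Main

variable {n : ℕ} {Y : Type*} [TopologicalSpace Y] [ChartedSpace (EuclideanQuadrant n) Y]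
  {J : Type*} {U : J → Set Y}

/-- A set that is a coordinate quadrant of an adapted chart has a corner chart. -/
theorem AdaptedChart.nonempty_cornerChart [Finite J] {p : Y} {N B : Set Y}
    (A : AdaptedChart (n := n) U p N) {s : Finset (Fin n)}
    (hB : B ∩ A.ψ.source = A.ψ.source ∩ A.ψ ⁻¹' signQuadrant n A.K s) :
    Nonempty (CornerChart n B p) := by
  classical
  -- The sign must change on `K \ s`; the change outside `L ∪ K` is harmless, as those coordinates
  -- are not faces.
  let S := flipOutside (A.L ∪ s)
  let e := A.Ψ.transHomeomorph S.toHomeomorph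
  refine ⟨{
    e := e
    faces := A.L ∪ A.K
    contDiffOn_e := S.contDiff.comp_contDiffOn A.contDiffOn_Ψ
    contDiffOn_symm := A.contDiffOn_symm.comp S.symm.contDiff.contDiffOn fun y hy => hy
    mem_source := A.mem_source
    map_base := (congrArg S A.map_base).trans (map_zero S)
    eventually_mem_iff := ?_ }⟩
  filter_upwards [A.Ψ.open_source.mem_nhds A.mem_source] with x hx
  have he : ∀ i, e x i = if i ∈ A.L ∪ s then A.Ψ x i else -A.Ψ x i := fun i =>
    flipOutside_apply _ _ _
  have hB' : x ∈ (extChartAt (𝓒 n) p).target →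
      ((extChartAt (𝓒 n) p).symm x ∈ B ↔ A.Ψ x ∈ signQuadrant n A.K s) := fun hxt => by
    have hsrc : (extChartAt (𝓒 n) p).symm x ∈ A.ψ.source := by
      refine A.mem_ψ_source.2 ⟨(extChartAt (𝓒 n) p).map_target hxt, ?_⟩
      rw [(extChartAt (𝓒 n) p).right_inv hxt]
      exact hx
    have hval : A.ψ ((extChartAt (𝓒 n) p).symm x) = A.Ψ x :=
      congrArg A.Ψ ((extChartAt (𝓒 n) p).right_inv hxt)
    have h1 := Set.ext_iff.1 hB ((extChartAt (𝓒 n) p).symm x)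
    rw [mem_inter_iff, mem_inter_iff, and_iff_left hsrc, and_iff_right hsrc, mem_preimage,
      hval] at h1
    exact h1
  rw [and_congr_right hB', A.mem_target_iff x hx]
  have hdisj := fun i (hi : i ∈ A.K) => Finset.disjoint_right.1 A.disjoint_L_K hi
  constructor
  · rintro ⟨hL, hK⟩ i hi
    rw [he]
    by_cases hiL : i ∈ A.L
    · simpa [hiL] using hL i hiL
    have hiK : i ∈ A.K := (Finset.mem_union.1 hi).resolve_left hiL
    by_cases his : i ∈ s
    · simpa [his] using (hK i hiK).1 his
    · simpa [his, hiL] using (hK i hiK).2 his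
  · intro h
    refine ⟨fun i hi => ?_, fun i hi => ⟨fun his => ?_, fun his => ?_⟩⟩
    · have := h i (Finset.mem_union_left _ hi)
      rw [he] at this
      simpa [hi] using this
    · have := h i (Finset.mem_union_right _ hi)
      rw [he] at this
      simpa [his] using this
    · have := h i (Finset.mem_union_right _ hi)
      rw [he] at this
      simpa [his, hdisj i hi] using this

/-- The points that lie on no frontier of a finite open covering are dense. -/
theorem dense_compl_iUnion_frontier [Finite J] (hU : ∀ j, IsOpen (U j)) :
    Dense (⋃ j, frontier (U j))ᶜ := by
  rw [compl_iUnion, ← sInter_range]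
  refine (finite_range _).dense_sInter ?_ ?_
  · rintro _ ⟨j, rfl⟩
    exact isClosed_frontier.isOpen_compl
  · rintro _ ⟨j, rfl⟩
    rw [← interior_eq_empty_iff_dense_compl, ← frontier_compl]
    exact interior_frontier (hU j).isClosed_compl

/-- Off the frontiers the characteristic map is locally constant, so it takes the value of the level
set that accumulates at `q`. -/
theorem coveringType_eq_of_mem_closure [Finite J] (hU : ∀ j, IsOpen (U j)) {q : Y}
    (hq : q ∉ ⋃ j, frontier (U j)) {T : Set J} (hT : q ∈ closure (coveringType U ⁻¹' {T})) :
    coveringType U q = T := by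
  have h : ∀ᶠ q' in 𝓝 q, coveringType U q' = coveringType U q := by
    have h1 : ∀ᶠ q' in 𝓝 q, ∀ j, q' ∈ U j ↔ q ∈ U j := eventually_all.2 fun j => by
      by_cases hj : q ∈ U j
      · filter_upwards [(hU j).mem_nhds hj] with q' hq' using iff_of_true hq' hj
      have hj' : q ∉ closure (U j) := fun h => hq (mem_iUnion.2 ⟨j, by
        rw [(hU j).frontier_eq]; exact ⟨h, hj⟩⟩)
      filter_upwards [isClosed_closure.isOpen_compl.mem_nhds hj'] with q' hq'
      exact iff_of_false (fun h => hq' (subset_closure h)) hj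
    filter_upwards [h1] with q' hq'
    ext j
    exact hq' j
  obtain ⟨q', hq', hq'T⟩ := ((mem_closure_iff_frequently.1 hT).and_eventually h).exists
  exact hq'T.symm.trans hq'

/-- An overlap of interiors would contain a point off all frontiers. Its type determines the level
set, so both blocks would be the component of that point in the same set. -/
theorem pairwise_disjoint_interior_associatedPartition [Finite J] (hU : ∀ j, IsOpen (U j)) :
    (associatedPartition U).Pairwise fun B B' => Disjoint (interior B) (interior B') := by
  rintro _ ⟨T, b, hb, rfl⟩ _ ⟨T', b', hb', rfl⟩ hne
  by_contra hdis
  obtain ⟨q, hq, hq'⟩ := not_disjoint_iff.1 hdis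
  obtain ⟨x, ⟨hx, hx'⟩, hxf⟩ := (dense_compl_iUnion_frontier hU).inter_open_nonempty _
    (isOpen_interior.inter isOpen_interior) ⟨q, hq, hq'⟩
  have hxB := interior_subset hx
  have hxB' := interior_subset hx'
  have h1 := coveringType_eq_of_mem_closure hU hxf (connectedComponentIn_subset _ _ hxB)
  have h2 := coveringType_eq_of_mem_closure hU hxf (connectedComponentIn_subset _ _ hxB')
  obtain rfl : T = T' := h1.symm.trans h2
  exact hne ((connectedComponentIn_eq hxB).trans (connectedComponentIn_eq hxB').symm)

end Main

theorem mainTheorem2 (n : ℕ) {Y : Type*} [TopologicalSpace Y] [T2Space Y] [ParacompactSpace Y]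
    [ChartedSpace (EuclideanQuadrant n) Y]
    [IsManifold (modelWithCornersEuclideanQuadrant n) ∞ Y]
    {J : Type*} [Finite J] (U : J → Set Y) (hU : IsRegularCovering n U) :
    IsRegularPartition n (associatedPartition U) where
  covers := eq_univ_of_forall fun p => by
    have hp : p ∈ closure (coveringType U ⁻¹' {coveringType U p}) := subset_closure rfl
    exact ⟨_, ⟨_, p, hp, rfl⟩, mem_connectedComponentIn hp⟩
  connected := by
    rintro _ ⟨T, b, hb, rfl⟩
    exact isConnected_connectedComponentIn_iff.2 hb
  submanifold := fun B hB p hp => by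
    -- The chart is centred at the given point of `B`, so `B` appears in it as exactly one quadrant.
    obtain ⟨A⟩ := hU.nonempty_adaptedChart (p := p) univ_mem
    obtain ⟨s, -, hBs⟩ := A.exists_inter_eq hU.isOpen hB ⟨p, hp, A.base_mem_ψ_source⟩
    obtain ⟨c⟩ := A.nonempty_cornerChart hBs
    exact ⟨_, c, rfl⟩
  disjoint := pairwise_disjoint_interior_associatedPartition hU.isOpen
  local_model := fun p N hN => by
    obtain ⟨A⟩ := hU.nonempty_adaptedChart hN
    exact ⟨A.L, A.K, A.ψ, openCube n A.r, A.disjoint_L_K, A.card_L, A.isOpen_ψ_source,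
      A.base_mem_ψ_source, fun q hq => A.mem_nhd q hq.1 hq.2, A.ψ_base, isOpen_openCube n A.r,
      A.ψ_target_eq, A.contMDiffOn_ψ, A.contMDiffOn_ψ_symm, A.setOf_inter_eq hU.isOpen⟩
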